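/- Let $T>0$, $n\ge 0$, $N=2n+1$, $J_N=[-\tfrac{N}{2T},\tfrac{N}{2T}]$, $\Omega=\tfrac1T\{-n,\dots,n\}$, $r\ge 2$, $L\ge 1$. Let $g\in L_1(\mathbb R)$ be complex-valued with Fourier transform $\widehat g(f)=\int e^{-2i\pi ft}g(t)\,dt$, and let $\widehat{g'}(f)=2i\pi f\,\widehat g(f)$ be the Fourier transform of its distributional derivative $g'$. For $h\in\{g,g'\}$ put $$E_h=\int_{J_N}|\widehat h(f)|^2\,df,\qquad \rho_h=E_h^{-1}\,\mathrm{TV}\big(|\widehat h|^2\mathbb 1_{J_N}\big),$$ where $\mathrm{TV}$ is the total variation of a function on $\mathbb R$; assume $E_g\neq 0$ and $\mathrm{TV}(|\widehat g|^2\mathbb 1_{J_N})<\infty$. Let $\bm G=\mathrm{diag}(\widehat g(f))_{f\in\Omega}$, and for $\tau\in\mathbb R^r$ let $\bm V_\tau=(e^{-2i\pi f\tau_j})_{f\in\Omega,\,1\le j\le r}$. Let $\tau^\star,\widehat\tau\in\mathbb R^r$, let $0\neq A^\star\in\mathbb C^{r\times L}$, and let $$\Delta=\min_{j\neq j'}\min_{p\in\mathbb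 Z}|\tau^\star_j-\tau^\star_{j'}+pT|,\qquad \mathrm{md}(\widehat\tau;\tau^\star)=\min_{\pi\in\mathfrak S_r}\max_{1\le k\le r}|\tau^\star_k-\widehat\tau_{\pi(k)}|.$$ Suppose $\mathrm{md}(\widehat\tau;\tau^\star)\le\delta$ and $\Delta-2\delta>\tfrac12\rho_g$. Let $\widehat A$ be a least squares estimate of the amplitudes given $\widehat\tau$ from the noise-free data $Y=\bm G\bm V_{\tau^\star}A^\star$, i.e. a minimizer of $A\mapsto\tfrac12\|\bm G\bm V_{\widehat\tau}A-Y\|_F^2$ over $\mathbb C^{r\times L}$. Then there is a permutation $\pi$ with $|\tau^\star_k-\widehat\tau_{\pi(k)}|\le\delta$ for all $k$, and for every such $\pi$ the estimate with its rows ordered accordingly, $\widehat A^{\pi}=(\widehat A_{\pi(k),\ell})_{k,\ell}$, satisfies $$\frac{\|A^\star-\widehat A^{\pi}\|_F}{\|A^\star\|_F}\le\delta\sqrt{\frac{E_{g'}}{E_g}\cdot\frac{1+\tfrac23\rho_{g'}(\Delta-2\delta)^{-1}}{1-\tfrac12\rho_g(\Delta-2\delta)^{-1}}}.$$ -/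

import Mathlib

open scoped FourierTransform SchwartzMap
open MeasureTheory

attribute [local instance] Matrix.frobeniusNormedAddCommGroup

namespace SpikeDeconv

noncomputable section

/-- The frequency band `J_N = [-N/(2T), N/(2T)]` with `N = 2n+1`. -/
def band (T : ℝ) (n : ℕ) : Set ℝ :=
  Set.Icc (-((2 * n + 1 : ℝ) / (2 * T))) ((2 * n + 1 : ℝ) / (2 * T))

/-- The sampling frequencies: `freq T n u` runs over `(1/T) {-n, …, n}`. -/
def freq (T : ℝ) (n : ℕ) (u : Fin (2 * n + 1)) : ℝ :=
  (((u : ℕ) : ℝ) - n) / T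

/-- The spectrum `f ↦ 2 i π f ĝ(f)` of the derivative `g'` of an integrable function `g`,
where `g'` is understood in the sense of distributions
(see `fourier_distributional_deriv` and `fourier_classical_deriv`). -/
def derivSpectrum (g : ℝ → ℂ) (f : ℝ) : ℂ :=
  2 * Real.pi * Complex.I * f * 𝓕 g f

/-- For differentiable `g` with `g` and `g'` integrable, `derivSpectrum g` is the Fourier
transform of the classical derivative. -/
theorem fourier_classical_deriv {g : ℝ → ℂ} (hg : Integrable g) (hd : Differentiable ℝ g)
    (hg' : Integrable (deriv g)) : 𝓕 (deriv g) = derivSpectrum g := by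
  rw [Real.fourier_deriv hg hd hg']
  funext f
  simp [derivSpectrum]

/-- For every integrable `g`, the Fourier transform of the distributional derivative of `g` (as a
tempered distribution) is the function `derivSpectrum g`. -/
theorem fourier_distributional_deriv {g : ℝ → ℂ} (hg : Integrable g) (φ : 𝓢(ℝ, ℂ)) :
    𝓕 (TemperedDistribution.derivCLM ℂ
      (Lp.toTemperedDistribution (memLp_one_iff_integrable.2 hg).toLp)) φ
      = ∫ f, φ f * derivSpectrum g f := by
  have hφ : Integrable fun x : ℝ => x • φ x := by
    refine (integrable_norm_iff (by fun_prop)).1 ?_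
    simpa [norm_smul] using φ.integrable_pow_mul volume 1
  have hψ : Integrable fun x : ℝ => (-2 * Real.pi * Complex.I * x : ℂ) • φ x := by
    refine (hφ.const_mul (-2 * Real.pi * Complex.I : ℂ)).congr (.of_forall fun x => ?_)
    simp only [Complex.real_smul, smul_eq_mul]
    ring
  have hswap : ∫ x, (𝓕 fun x : ℝ => (-2 * Real.pi * Complex.I * x : ℂ) • φ x) x • g x
      = ∫ x : ℝ, ((-2 * Real.pi * Complex.I * x : ℂ) • φ x) • 𝓕 g x := by
    simpa using! VectorFourier.integral_fourierIntegral_smul_eq_flip (L := innerₗ ℝ)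
      Real.continuous_fourierChar continuous_inner hψ hg
  rw [TemperedDistribution.fourier_apply, TemperedDistribution.derivCLM_apply_apply,
    Lp.toTemperedDistribution_apply]
  have h1 : ∫ x, (-SchwartzMap.derivCLM ℂ ℂ (𝓕 φ)) x •
        (memLp_one_iff_integrable.2 hg).toLp g x
      = ∫ x, -((𝓕 fun x : ℝ => (-2 * Real.pi * Complex.I * x : ℂ) • φ x) x • g x) := by
    refine integral_congr_ae ?_
    filter_upwards [(memLp_one_iff_integrable.2 hg).coeFn_toLp] with x hx
    rw [hx, ← Real.deriv_fourier φ.integrable hφ]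
    simp [SchwartzMap.fourier_coe]
  rw [h1, integral_neg, hswap, ← integral_neg]
  refine integral_congr_ae (.of_forall fun x => ?_)
  simp only [smul_eq_mul, derivSpectrum]
  ring

/-- The band-limited energy of a signal with spectrum `h`: `∫_{J_N} |h(f)|² df`. -/
def bandEnergy (T : ℝ) (n : ℕ) (h : ℝ → ℂ) : ℝ :=
  ∫ f in band T n, ‖h f‖ ^ 2

/-- The total variation over `ℝ` of the function `|h|² 1_{J_N}` (its jumps at the two ends of the
band included). -/
def bandVariation (T : ℝ) (n : ℕ) (h : ℝ → ℂ) : ENNReal :=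
  eVariationOn ((band T n).indicator fun f => ‖h f‖ ^ 2) Set.univ

/-- The flatness measure of the power spectral density of a signal with spectrum `h`: total
variation of `|h|² 1_{J_N}` divided by the band-limited energy. -/
def flatness (T : ℝ) (n : ℕ) (h : ℝ → ℂ) : ℝ :=
  (bandEnergy T n h)⁻¹ * (bandVariation T n h).toReal

/-- The minimal separation on the torus `ℝ / Tℤ` of the locations `τ`. -/
def separation {r : ℕ} (T : ℝ) (τ : Fin r → ℝ) : ℝ :=
  sInf {d : ℝ | ∃ (j k : Fin r) (p : ℤ), j ≠ k ∧ d = |τ j - τ k + p * T|}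

/-- The matching distance `min_π max_k |τ_k - τ'_{π(k)}|` between `τ'` and `τ`. -/
def matchingDist {r : ℕ} (τ' τ : Fin r → ℝ) : ℝ :=
  ⨅ π : Equiv.Perm (Fin r), ⨆ k : Fin r, |τ k - τ' (π k)|

/-- The Vandermonde matrix with entries `exp(-2 i π f_u τ_j)`. -/
def vandermonde {r : ℕ} (T : ℝ) (n : ℕ) (τ : Fin r → ℝ) :
    Matrix (Fin (2 * n + 1)) (Fin r) ℂ :=
  Matrix.of fun u j => Complex.exp (-2 * Complex.I * Real.pi * freq T n u * τ j)

/-- The diagonal matrix of the samples of the spectrum of `g`. -/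
def psfMatrix (T : ℝ) (n : ℕ) (g : ℝ → ℂ) :
    Matrix (Fin (2 * n + 1)) (Fin (2 * n + 1)) ℂ :=
  Matrix.diagonal fun u => 𝓕 g (freq T n u)

/-- The quadratic loss `½ ‖G V_τ A - Y‖_F²`. -/
def loss {r L : ℕ} (T : ℝ) (n : ℕ) (g : ℝ → ℂ) (Y : Matrix (Fin (2 * n + 1)) (Fin L) ℂ)
    (A : Matrix (Fin r) (Fin L) ℂ) (τ : Fin r → ℝ) : ℝ :=
  1 / 2 * ‖psfMatrix T n g * vandermonde T n τ * A - Y‖ ^ 2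

/-- `A` is a least squares estimate of the amplitudes from the data `Y`, given the locations `τ`:
it minimizes the loss over all amplitude matrices. -/
def IsLeastSquares {r L : ℕ} (T : ℝ) (n : ℕ) (g : ℝ → ℂ)
    (Y : Matrix (Fin (2 * n + 1)) (Fin L) ℂ) (τ : Fin r → ℝ)
    (A : Matrix (Fin r) (Fin L) ℂ) : Prop :=
  ∀ B : Matrix (Fin r) (Fin L) ℂ, loss T n g Y A τ ≤ loss T n g Y B τ

end

end SpikeDeconv

namespace SpikeDeconv

/-- Points on the circle `ℝ / ℤ` at mutual distance at least `ε`. -/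
def CircleSeparated {ι : Type*} (ε : ℝ) (y : ι → ℝ) : Prop :=
  ∀ j k, j ≠ k → ∀ p : ℤ, ε ≤ |y j - y k + p|

theorem sq_mul_one_add_two_mul_cos_le {x : ℝ} (h0 : 0 ≤ x) (h1 : x ≤ Real.pi / 2) :
    x ^ 2 * (1 + 2 * Real.cos x) ≤ 3 * Real.sin x ^ 2 := by
  have hx2 : x ≤ 2 := by linarith [Real.pi_le_four]
  have hc : Real.cos x ≤ 1 - x ^ 2 / 2 + x ^ 4 / 24 := by
    have h := Real.sin_ge_sub_cube (x := x / 2) (by positivity)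
    have h' : Real.cos x = 1 - 2 * Real.sin (x / 2) ^ 2 := by
      have h2 := Real.cos_sq' (x / 2)
      have h3 := Real.cos_two_mul (x / 2)
      rw [mul_div_cancel₀ x two_ne_zero] at h3
      linarith
    have hp : 0 ≤ x / 2 - (x / 2) ^ 3 / 6 := by nlinarith [mul_nonneg h0 h0, mul_nonneg h0 (mul_nonneg h0 h0)]
    have := pow_le_pow_left₀ hp h 2
    nlinarith [pow_nonneg h0 6]
  have hs := Real.sin_ge_sub_cube h0
  have hp : 0 ≤ x - x ^ 3 / 6 := by nlinarith [mul_nonneg h0 h0, mul_nonneg h0 (mul_nonneg h0 h0)]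
  have h4 := pow_le_pow_left₀ hp hs 2
  have h5 := mul_le_mul_of_nonneg_left hc (sq_nonneg x)
  nlinarith

/-- The function `csc² + 2 |csc cot|` of `π t`. -/
noncomputable def cscKernel (t : ℝ) : ℝ :=
  (Real.sin (Real.pi * t))⁻¹ ^ 2 +
    2 * |(Real.sin (Real.pi * t))⁻¹ * (Real.cos (Real.pi * t) / Real.sin (Real.pi * t))|

theorem cscKernel_eq (t : ℝ) :
    cscKernel t = (1 + 2 * |Real.cos (Real.pi * t)|) / Real.sin (Real.pi * t) ^ 2 := by
  rw [cscKernel, div_eq_mul_inv, abs_mul, abs_mul, abs_inv, div_eq_mul_inv, inv_pow,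
    ← sq_abs (Real.sin _)]
  ring

theorem cscKernel_neg (t : ℝ) : cscKernel (-t) = cscKernel t := by
  simp [cscKernel_eq]

theorem cscKernel_add_int (t : ℝ) (p : ℤ) : cscKernel (t + p) = cscKernel t := by
  have : Real.pi * (t + p) = Real.pi * t + p * Real.pi := by ring
  rw [cscKernel_eq, cscKernel_eq, this, Real.cos_add_int_mul_pi, Real.sin_add_int_mul_pi, abs_mul,
    mul_pow]
  have h1 : |((-1 : ℝ) ^ p)| = 1 := by rw [abs_zpow]; simp
  have h2 : ((-1 : ℝ) ^ p) ^ 2 = 1 := by rw [← sq_abs, h1, one_pow]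
  rw [h1, h2]; simp

theorem cscKernel_le {t : ℝ} (h0 : 0 < t) (h1 : t ≤ 1 / 2) :
    cscKernel t ≤ 3 / (Real.pi * t) ^ 2 := by
  have hp := Real.pi_pos
  have hle : Real.pi * t ≤ Real.pi / 2 := by nlinarith
  have hpos : 0 < Real.pi * t := by positivity
  have hs : 0 < Real.sin (Real.pi * t) := Real.sin_pos_of_pos_of_lt_pi hpos (by linarith)
  have hc : 0 ≤ Real.cos (Real.pi * t) := Real.cos_nonneg_of_mem_Icc ⟨by linarith, hle⟩
  rw [cscKernel_eq, abs_of_nonneg hc, div_le_div_iff₀ (by positivity) (by positivity), mul_comm]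
  exact sq_mul_one_add_two_mul_cos_le hpos.le hle

theorem sum_inv_sq_le {ι : Type*} (s : Finset ι) {ε : ℝ} (hε : 0 < ε) (t : ι → ℝ)
    (ht : ∀ j ∈ s, ε ≤ t j) (hsep : ∀ j ∈ s, ∀ k ∈ s, j ≠ k → ε ≤ |t j - t k|) :
    ∑ j ∈ s, 1 / t j ^ 2 ≤ Real.pi ^ 2 / 6 * ε⁻¹ ^ 2 := by
  classical
  have hinj : Set.InjOn (fun j => ⌊t j / ε⌋₊) (s : Set ι) := by
    intro j hj k hk hjk
    by_contra hne
    have h1 := hsep j hj k hk hne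
    have htj : 0 ≤ t j / ε := div_nonneg (hε.le.trans (ht j hj)) hε.le
    have htk : 0 ≤ t k / ε := div_nonneg (hε.le.trans (ht k hk)) hε.le
    simp only at hjk
    have a1 := Nat.floor_le htj
    have a2 := Nat.lt_floor_add_one (t j / ε)
    have b1 := Nat.floor_le htk
    have b2 := Nat.lt_floor_add_one (t k / ε)
    rw [hjk] at a1 a2
    have h2 : |t j / ε - t k / ε| < 1 := by rw [abs_lt]; constructor <;> linarith
    rw [← sub_div, abs_div, abs_of_pos hε, div_lt_one hε] at h2
    linarith
  have hterm : ∀ j ∈ s, 1 / t j ^ 2 ≤ ε⁻¹ ^ 2 * (1 / ((⌊t j / ε⌋₊ : ℕ) : ℝ) ^ 2) := by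
    intro j hj
    have htj : 1 ≤ t j / ε := (one_le_div hε).2 (ht j hj)
    have hf : (1 : ℝ) ≤ ⌊t j / ε⌋₊ := by exact_mod_cast (Nat.one_le_floor_iff _).2 htj
    have h1 : ε * ⌊t j / ε⌋₊ ≤ t j := by
      have := Nat.floor_le (zero_le_one.trans htj)
      rw [le_div_iff₀ hε] at this
      linarith
    rw [inv_pow, ← one_div, one_div_mul_one_div, ← mul_pow]
    apply one_div_le_one_div_of_le (by positivity)
    exact pow_le_pow_left₀ (by positivity) h1 2
  calc ∑ j ∈ s, 1 / t j ^ 2 ≤ ∑ j ∈ s, ε⁻¹ ^ 2 * (1 / ((⌊t j / ε⌋₊ : ℕ) : ℝ) ^ 2) :=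
        Finset.sum_le_sum hterm
    _ = ε⁻¹ ^ 2 * ∑ m ∈ s.image (fun j => ⌊t j / ε⌋₊), 1 / (m : ℝ) ^ 2 := by
        rw [Finset.sum_image hinj, Finset.mul_sum]
    _ ≤ ε⁻¹ ^ 2 * (Real.pi ^ 2 / 6) := by
        gcongr
        exact sum_le_hasSum _ (fun _ _ => by positivity) hasSum_zeta_two
    _ = _ := mul_comm _ _

theorem CircleSeparated.sum_cscKernel_le {ι : Type*} [Fintype ι] [DecidableEq ι] {ε : ℝ}
    (hε : 0 < ε) {y : ι → ℝ} (hy : CircleSeparated ε y) (k : ι) :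
    ∑ j ∈ Finset.univ.erase k, cscKernel (y j - y k) ≤ ε⁻¹ ^ 2 := by
  set t : ι → ℝ := fun j => y j - y k - round (y j - y k) with ht
  have hker : ∀ j, cscKernel (y j - y k) = cscKernel |t j| := by
    intro j
    have h1 : cscKernel |t j| = cscKernel (t j) := by
      rcases abs_choice (t j) with h | h <;> rw [h]
      exact cscKernel_neg _
    rw [h1, ← cscKernel_add_int (t j) (round (y j - y k))]
    simp [ht]
  have hhalf : ∀ j, |t j| ≤ 1 / 2 := fun j => abs_sub_round _
  have hge : ∀ j ∈ Finset.univ.erase k, ε ≤ |t j| := by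
    intro j hj
    have := hy j k (Finset.ne_of_mem_erase hj) (-round (y j - y k))
    push_cast at this
    simpa [ht, sub_eq_add_neg] using this
  have hsep : ∀ j l, j ≠ l → ε ≤ |t j - t l| := by
    intro j l hjl
    have := hy j l hjl (round (y l - y k) - round (y j - y k))
    push_cast at this
    convert this using 2
    simp only [ht]; ring
  have hb : ∀ s ⊆ Finset.univ.erase k, (∀ j ∈ s, ∀ l ∈ s, j ≠ l → ε ≤ |(|t j| - |t l|)|) →
      ∑ j ∈ s, cscKernel (y j - y k) ≤ ε⁻¹ ^ 2 / 2 := by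
    intro s hs hsep'
    calc ∑ j ∈ s, cscKernel (y j - y k) ≤ ∑ j ∈ s, 3 / Real.pi ^ 2 * (1 / |t j| ^ 2) := by
          refine Finset.sum_le_sum fun j hj => ?_
          rw [hker]
          refine (cscKernel_le (hε.trans_le (hge j (hs hj))) (hhalf j)).trans_eq ?_
          rw [mul_pow, div_mul_div_comm, mul_one]
      _ = 3 / Real.pi ^ 2 * ∑ j ∈ s, 1 / |t j| ^ 2 := by rw [Finset.mul_sum]
      _ ≤ 3 / Real.pi ^ 2 * (Real.pi ^ 2 / 6 * ε⁻¹ ^ 2) := by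
          gcongr
          exact sum_inv_sq_le s hε _ (fun j hj => hge j (hs hj)) hsep'
      _ = ε⁻¹ ^ 2 / 2 := by
          have := Real.pi_ne_zero
          field_simp; norm_num
  rw [← Finset.sum_filter_add_sum_filter_not _ (fun j => 0 ≤ t j)]
  have h1 := hb ((Finset.univ.erase k).filter fun j => 0 ≤ t j) (Finset.filter_subset _ _) (by
    intro j hj l hl hjl
    rw [abs_of_nonneg (Finset.mem_filter.1 hj).2, abs_of_nonneg (Finset.mem_filter.1 hl).2]
    exact hsep j l hjl)
  have h2 := hb ((Finset.univ.erase k).filter fun j => ¬ 0 ≤ t j) (Finset.filter_subset _ _) (by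
    intro j hj l hl hjl
    rw [abs_of_neg (not_le.1 (Finset.mem_filter.1 hj).2),
      abs_of_neg (not_le.1 (Finset.mem_filter.1 hl).2), neg_sub_neg, abs_sub_comm]
    exact hsep j l hjl)
  linarith

theorem CircleSeparated.sin_ne_zero {ι : Type*} {ε : ℝ} (hε : 0 < ε) {y : ι → ℝ}
    (hy : CircleSeparated ε y) {j k : ι} (h : j ≠ k) : Real.sin (Real.pi * (y j - y k)) ≠ 0 := by
  intro h0
  obtain ⟨p, hp⟩ := Real.sin_eq_zero_iff.1 h0
  have h1 : y j - y k = p := by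
    have := Real.pi_ne_zero
    apply mul_left_cancel₀ this
    linarith
  have := hy j k h (-p)
  rw [h1] at this
  simp at this
  linarith

/-- The entries `csc π (y j - y k)`, zero on the diagonal. -/
noncomputable def cscEntry {ι : Type*} (y : ι → ℝ) (j k : ι) : ℝ :=
  (Real.sin (Real.pi * (y j - y k)))⁻¹

/-- The entries `cot π (y j - y k)`, zero on the diagonal. -/
noncomputable def cotEntry {ι : Type*} (y : ι → ℝ) (j k : ι) : ℝ :=
  Real.cos (Real.pi * (y j - y k)) / Real.sin (Real.pi * (y j - y k))

theorem cscEntry_self {ι : Type*} (y : ι → ℝ) (j : ι) : cscEntry y j j = 0 := by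
  simp [cscEntry]

theorem cotEntry_self {ι : Type*} (y : ι → ℝ) (j : ι) : cotEntry y j j = 0 := by
  simp [cotEntry]

theorem cscEntry_swap {ι : Type*} (y : ι → ℝ) (j k : ι) : cscEntry y j k = -cscEntry y k j := by
  have : Real.pi * (y j - y k) = -(Real.pi * (y k - y j)) := by ring
  rw [cscEntry, cscEntry, this, Real.sin_neg, inv_neg]

theorem cotEntry_swap {ι : Type*} (y : ι → ℝ) (j k : ι) : cotEntry y j k = -cotEntry y k j := by
  have : Real.pi * (y j - y k) = -(Real.pi * (y k - y j)) := by ring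
  rw [cotEntry, cotEntry, this, Real.sin_neg, Real.cos_neg, div_neg]

theorem CircleSeparated.cscEntry_mul_cscEntry {ι : Type*} [DecidableEq ι] {ε : ℝ} (hε : 0 < ε)
    {y : ι → ℝ} (hy : CircleSeparated ε y) (j k l : ι) :
    cscEntry y j k * cscEntry y j l = (if k = l then cscEntry y j k ^ 2 else 0) +
      cscEntry y l k * (cotEntry y j l - cotEntry y j k) +
      ((if j = k then 1 else 0) + (if j = l then 1 else 0)) *
        (cscEntry y l k * cotEntry y l k) := by
  by_cases hkl : k = l
  · subst hkl
    simp [cscEntry_self, sq]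
  by_cases hjk : j = k
  · subst hjk
    simp only [cscEntry_self, cotEntry_self, hkl, if_true, if_false]
    rw [cotEntry_swap y l j]; ring
  by_cases hjl : j = l
  · subst hjl
    simp only [cscEntry_self, cotEntry_self, hjk, hkl, if_true, if_false]
    ring
  simp only [hkl, hjk, hjl, if_false, zero_add, add_zero, zero_mul]
  have h1 := hy.sin_ne_zero hε hjk
  have h2 := hy.sin_ne_zero hε hjl
  have h3 := hy.sin_ne_zero hε (Ne.symm hkl)
  have hs : Real.sin (Real.pi * (y l - y k)) =
      Real.sin (Real.pi * (y j - y k)) * Real.cos (Real.pi * (y j - y l)) -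
        Real.cos (Real.pi * (y j - y k)) * Real.sin (Real.pi * (y j - y l)) := by
    rw [← Real.sin_sub]; congr 1; ring
  rw [cscEntry, cscEntry, cscEntry, cotEntry, cotEntry]
  field_simp
  rw [hs]; ring

theorem CircleSeparated.gram_cscEntry {ι : Type*} [Fintype ι] [DecidableEq ι] {ε : ℝ} (hε : 0 < ε)
    {y : ι → ℝ} (hy : CircleSeparated ε y) (k l : ι) :
    ∑ j, cscEntry y j k * cscEntry y j l = (if k = l then ∑ j, cscEntry y j k ^ 2 else 0) +
      cscEntry y l k * (∑ j, cotEntry y j l - ∑ j, cotEntry y j k) +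
      2 * (cscEntry y l k * cotEntry y l k) := by
  simp_rw [hy.cscEntry_mul_cscEntry hε, Finset.sum_add_distrib, ← Finset.mul_sum,
    Finset.sum_sub_distrib, ← Finset.sum_mul, Finset.sum_add_distrib]
  have h : (∑ j, if k = l then cscEntry y j k ^ 2 else 0) =
      if k = l then ∑ j, cscEntry y j k ^ 2 else 0 := by
    split_ifs <;> simp
  rw [h]
  simp only [Finset.sum_ite_eq', Finset.mem_univ, if_true]
  ring

theorem CircleSeparated.eigenvalue_bound {ι : Type*} [Fintype ι] [DecidableEq ι] {ε : ℝ}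
    (hε : 0 < ε) {y : ι → ℝ} (hy : CircleSeparated ε y) {v : ι → ℂ} {μ : ℂ}
    (hμ : star μ = -μ) (hv : ∀ j, ∑ k, (cscEntry y j k : ℂ) * v k = μ * v j) :
    ‖μ‖ ^ 2 * ∑ j, ‖v j‖ ^ 2 ≤ ε⁻¹ ^ 2 * ∑ j, ‖v j‖ ^ 2 := by
  set S : ι → ℝ := fun l => ∑ j, cotEntry y j l with hS
  have hnorm : ∀ z : ℂ, ((‖z‖ ^ 2 : ℝ) : ℂ) = z * star z := fun z => by
    rw [Complex.star_def, Complex.mul_conj, Complex.normSq_eq_norm_sq]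
  have hcol : ∀ k, ∑ l, (cscEntry y l k : ℂ) * star (v l) = μ * star (v k) := by
    intro k
    have h1 := congrArg star (hv k)
    simp only [star_sum, star_mul', hμ] at h1
    have h2 : ∑ l, (cscEntry y l k : ℂ) * star (v l) =
        -∑ l, star (cscEntry y k l : ℂ) * star (v l) := by
      rw [← Finset.sum_neg_distrib]
      refine Finset.sum_congr rfl fun l _ => ?_
      rw [cscEntry_swap y k l]
      simp
    rw [h2, h1]; ring
  have hX1 : ∑ k, ∑ l, (cscEntry y l k : ℂ) * S l * (v k * star (v l)) =
      ∑ l, μ * S l * (v l * star (v l)) := by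
    rw [Finset.sum_comm]
    refine Finset.sum_congr rfl fun l _ => ?_
    calc _ = (∑ k, (cscEntry y l k : ℂ) * v k) * (S l * star (v l)) := by
          rw [Finset.sum_mul]; exact Finset.sum_congr rfl fun k _ => by ring
      _ = _ := by rw [hv]; ring
  have hX2 : ∑ k, ∑ l, (cscEntry y l k : ℂ) * S k * (v k * star (v l)) =
      ∑ l, μ * S l * (v l * star (v l)) := by
    refine Finset.sum_congr rfl fun k _ => ?_
    calc _ = (∑ l, (cscEntry y l k : ℂ) * star (v l)) * (S k * v k) := by
          rw [Finset.sum_mul]; exact Finset.sum_congr rfl fun k _ => by ring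
      _ = _ := by rw [hcol]; ring
  have hmain : ((‖μ‖ ^ 2 * ∑ j, ‖v j‖ ^ 2 : ℝ) : ℂ) =
      ((∑ k, (∑ j, cscEntry y j k ^ 2) * ‖v k‖ ^ 2 : ℝ) : ℂ) +
      2 * ∑ k, ∑ l, ((cscEntry y l k * cotEntry y l k : ℝ) : ℂ) * (v k * star (v l)) := by
    calc ((‖μ‖ ^ 2 * ∑ j, ‖v j‖ ^ 2 : ℝ) : ℂ) = ∑ j, (μ * v j) * star (μ * v j) := by
          rw [Finset.mul_sum, Complex.ofReal_sum]
          refine Finset.sum_congr rfl fun j _ => ?_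
          rw [← hnorm, norm_mul, mul_pow]
      _ = ∑ j, ∑ k, ∑ l, ((cscEntry y j k * cscEntry y j l : ℝ) : ℂ) * (v k * star (v l)) := by
          refine Finset.sum_congr rfl fun j _ => ?_
          rw [← hv, star_sum, Finset.sum_mul_sum]
          refine Finset.sum_congr rfl fun k _ => Finset.sum_congr rfl fun l _ => ?_
          rw [star_mul', Complex.ofReal_mul]
          simp only [Complex.star_def, Complex.conj_ofReal]; ring
      _ = ∑ k, ∑ l, ((∑ j, cscEntry y j k * cscEntry y j l : ℝ) : ℂ) * (v k * star (v l)) := by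
          rw [Finset.sum_comm]
          refine Finset.sum_congr rfl fun k _ => ?_
          rw [Finset.sum_comm]
          refine Finset.sum_congr rfl fun l _ => ?_
          rw [Complex.ofReal_sum, Finset.sum_mul]
      _ = ∑ k, ∑ l, ((if k = l then ((∑ j, cscEntry y j k ^ 2 : ℝ) : ℂ) * (v k * star (v k)) else 0)
            + (cscEntry y l k : ℂ) * S l * (v k * star (v l))
            - (cscEntry y l k : ℂ) * S k * (v k * star (v l))
            + 2 * (((cscEntry y l k * cotEntry y l k : ℝ) : ℂ) * (v k * star (v l)))) := by
          refine Finset.sum_congr rfl fun k _ => Finset.sum_congr rfl fun l _ => ?_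
          rw [hy.gram_cscEntry hε]
          by_cases hkl : k = l
          · subst hkl
            simp only [if_true, hS]
            push_cast; ring
          · simp only [hkl, if_false, hS]
            push_cast; ring
      _ = _ := by
          simp_rw [Finset.sum_add_distrib, Finset.sum_sub_distrib, Finset.sum_add_distrib]
          rw [hX1, hX2]
          simp only [Finset.sum_ite_eq, Finset.mem_univ, if_true, ← hnorm, ← Finset.mul_sum]
          push_cast
          ring
  have hre := congrArg Complex.re hmain
  rw [Complex.ofReal_re, Complex.add_re, Complex.ofReal_re] at hre
  set w : ι → ι → ℝ := fun l k => |cscEntry y l k * cotEntry y l k| with hw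
  have hwsymm : ∀ k l, w l k = w k l := fun k l => by
    simp only [hw]; rw [cscEntry_swap y l k, cotEntry_swap y l k, neg_mul_neg]
  have hb : (2 * ∑ k, ∑ l, ((cscEntry y l k * cotEntry y l k : ℝ) : ℂ) * (v k * star (v l))).re ≤
      2 * ∑ k, (∑ l, w l k) * ‖v k‖ ^ 2 := by
    calc _ ≤ ‖2 * ∑ k, ∑ l, ((cscEntry y l k * cotEntry y l k : ℝ) : ℂ) * (v k * star (v l))‖ :=
          Complex.re_le_norm _
      _ ≤ 2 * ∑ k, ∑ l, w l k * (‖v k‖ * ‖v l‖) := by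
          rw [norm_mul, Complex.norm_two]
          gcongr
          refine (norm_sum_le _ _).trans (Finset.sum_le_sum fun k _ => (norm_sum_le _ _).trans
            (Finset.sum_le_sum fun l _ => ?_))
          rw [norm_mul, norm_mul, norm_star, Complex.norm_real, Real.norm_eq_abs]
      _ ≤ ∑ k, ∑ l, w l k * (‖v k‖ ^ 2 + ‖v l‖ ^ 2) := by
          simp_rw [Finset.mul_sum]
          refine Finset.sum_le_sum fun k _ => Finset.sum_le_sum fun l _ => ?_
          have h0 : 0 ≤ w l k := abs_nonneg _
          nlinarith [sq_nonneg (‖v k‖ - ‖v l‖), mul_nonneg h0 (sq_nonneg (‖v k‖ - ‖v l‖))]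
      _ = ∑ k, ∑ l, w l k * ‖v k‖ ^ 2 + ∑ k, ∑ l, w l k * ‖v l‖ ^ 2 := by
          simp_rw [mul_add, Finset.sum_add_distrib]
      _ = ∑ k, ∑ l, w l k * ‖v k‖ ^ 2 + ∑ k, ∑ l, w l k * ‖v k‖ ^ 2 := by
          congr 1
          rw [Finset.sum_comm]
          exact Finset.sum_congr rfl fun k _ => Finset.sum_congr rfl fun l _ => by rw [hwsymm]
      _ = _ := by simp_rw [Finset.sum_mul]; ring
  rw [hre]
  calc _ ≤ ∑ k, (∑ j, cscEntry y j k ^ 2) * ‖v k‖ ^ 2 + 2 * ∑ k, (∑ l, w l k) * ‖v k‖ ^ 2 := by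
        gcongr
    _ = ∑ k, (∑ j, cscKernel (y j - y k)) * ‖v k‖ ^ 2 := by
        rw [Finset.mul_sum, ← Finset.sum_add_distrib]
        refine Finset.sum_congr rfl fun k _ => ?_
        have : ∑ j, cscKernel (y j - y k) = ∑ j, cscEntry y j k ^ 2 + 2 * ∑ j, w j k := by
          rw [Finset.mul_sum, ← Finset.sum_add_distrib]; rfl
        rw [this]; ring
    _ ≤ ∑ k, ε⁻¹ ^ 2 * ‖v k‖ ^ 2 := by
        gcongr with k
        have h := hy.sum_cscKernel_le hε k
        rwa [Finset.sum_erase] at h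
        simp [cscKernel]
    _ = _ := by rw [Finset.mul_sum]

open scoped ComplexOrder in
theorem CircleSeparated.im_cscForm_ge {ι : Type*} [Fintype ι] {ε : ℝ}
    (hε : 0 < ε) {y : ι → ℝ} (hy : CircleSeparated ε y) (b : ι → ℂ) :
    -(ε⁻¹ * ∑ j, ‖b j‖ ^ 2) ≤ (∑ j, ∑ k, b j * star (b k) * (cscEntry y j k : ℂ)).im := by
  classical
  set A : Matrix ι ι ℂ := Matrix.of fun j k => (cscEntry y j k : ℂ) with hA
  set M : Matrix ι ι ℂ := ((ε⁻¹ : ℝ) : ℂ) • (1 : Matrix ι ι ℂ) - Complex.I • A with hM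
  have hMv : ∀ v : ι → ℂ, M.mulVec v = fun j =>
      ((ε⁻¹ : ℝ) : ℂ) * v j - Complex.I * ∑ k, (cscEntry y j k : ℂ) * v k := by
    intro v; funext j
    rw [hM, Matrix.sub_mulVec, Matrix.smul_mulVec, Matrix.smul_mulVec, Matrix.one_mulVec]
    simp [hA, Matrix.mulVec, dotProduct]
  have hH : M.IsHermitian := by
    ext j k
    simp only [hM, hA, Matrix.conjTranspose_apply, Matrix.sub_apply, Matrix.smul_apply,
      Matrix.of_apply, smul_eq_mul, star_sub, star_mul', Complex.star_def, Complex.conj_ofReal,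
      Complex.conj_I]
    rw [cscEntry_swap y k j, Matrix.one_apply, Matrix.one_apply]
    by_cases h : j = k
    · subst h; simp
    · simp [h, Ne.symm h]
  have hpos : M.PosSemidef := by
    rw [hH.posSemidef_iff_eigenvalues_nonneg]
    intro i
    set v : ι → ℂ := ⇑(hH.eigenvectorBasis i) with hvdef
    set t : ℝ := hH.eigenvalues i with ht
    have hv := hH.mulVec_eigenvectorBasis i
    rw [← hvdef, ← ht, hMv] at hv
    have hv1 : ∑ j, ‖v j‖ ^ 2 = 1 := by
      have h1 := hH.eigenvectorBasis.orthonormal.1 i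
      have h2 := EuclideanSpace.norm_sq_eq (hH.eigenvectorBasis i)
      rw [h1] at h2
      simpa [hvdef] using h2.symm
    have h := hy.eigenvalue_bound hε (v := v) (μ := -Complex.I * ((ε⁻¹ - t : ℝ) : ℂ))
      (by simp) (by
        intro j
        have h1 := congrFun hv j
        simp only [Pi.smul_apply, Complex.real_smul] at h1
        have h2 : Complex.I * Complex.I = -1 := Complex.I_mul_I
        push_cast at h1 ⊢
        linear_combination (Complex.I) * h1 +
          (∑ k, (cscEntry y j k : ℂ) * v k) * h2)
    rw [hv1, mul_one, mul_one, norm_mul, norm_neg, Complex.norm_I, one_mul, Complex.norm_real,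
      Real.norm_eq_abs, sq_abs] at h
    have h3 := abs_le_of_sq_le_sq h (by positivity)
    show 0 ≤ t
    linarith [(abs_le.1 h3).2]
  have h := hpos.re_dotProduct_nonneg (star b)
  rw [hMv] at h
  have e : star (star b) ⬝ᵥ (fun j => ((ε⁻¹ : ℝ) : ℂ) * (star b) j -
      Complex.I * ∑ k, (cscEntry y j k : ℂ) * (star b) k) =
      ((ε⁻¹ * ∑ j, ‖b j‖ ^ 2 : ℝ) : ℂ) -
        Complex.I * ∑ j, ∑ k, b j * star (b k) * (cscEntry y j k : ℂ) := by
    simp only [dotProduct, star_star, Pi.star_apply, mul_sub, Finset.sum_sub_distrib]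
    rw [Complex.ofReal_mul, Complex.ofReal_sum, Finset.mul_sum, Finset.mul_sum]
    congr 1
    · refine Finset.sum_congr rfl fun j _ => ?_
      rw [← Complex.normSq_eq_norm_sq, ← Complex.mul_conj, Complex.star_def]; ring
    · refine Finset.sum_congr rfl fun j _ => ?_
      rw [Finset.mul_sum, Finset.mul_sum, Finset.mul_sum]
      exact Finset.sum_congr rfl fun k _ => by ring
  rw [e] at h
  have h' : 0 ≤ (((ε⁻¹ * ∑ j, ‖b j‖ ^ 2 : ℝ) : ℂ) -
        Complex.I * ∑ j, ∑ k, b j * star (b k) * (cscEntry y j k : ℂ)).re := h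
  rw [Complex.sub_re, Complex.ofReal_re, Complex.I_mul_re] at h'
  linarith

/-- The Montgomery-Vaughan form of Hilbert's inequality on the circle. -/
theorem CircleSeparated.norm_cscForm_le {ι : Type*} [Fintype ι] {ε : ℝ}
    (hε : 0 < ε) {y : ι → ℝ} (hy : CircleSeparated ε y) (b : ι → ℂ) :
    ‖∑ j, ∑ k, b j * star (b k) * (cscEntry y j k : ℂ)‖ ≤ ε⁻¹ * ∑ j, ‖b j‖ ^ 2 := by
  set S := ∑ j, ∑ k, b j * star (b k) * (cscEntry y j k : ℂ) with hS
  have hstar : star S = -S := by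
    rw [hS, star_sum, Finset.sum_comm, ← Finset.sum_neg_distrib]
    refine Finset.sum_congr rfl fun j _ => ?_
    rw [star_sum, ← Finset.sum_neg_distrib]
    refine Finset.sum_congr rfl fun k _ => ?_
    rw [cscEntry_swap y k j]
    simp only [star_mul', Complex.star_def, Complex.conj_conj, Complex.conj_ofReal,
      Complex.ofReal_neg]
    ring
  have hre : S.re = 0 := by
    have := congrArg Complex.re hstar
    simp only [Complex.star_def, Complex.conj_re, Complex.neg_re] at this
    linarith
  have h1 := hy.im_cscForm_ge hε b
  have h2 := hy.im_cscForm_ge hε (star b)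
  have e : ∑ j, ∑ k, (star b) j * star ((star b) k) * (cscEntry y j k : ℂ) = star S := by
    rw [hS, star_sum]
    refine Finset.sum_congr rfl fun j _ => ?_
    rw [star_sum]
    refine Finset.sum_congr rfl fun k _ => ?_
    simp
  rw [e] at h2
  simp only [Pi.star_apply, norm_star] at h2
  rw [Complex.star_def, Complex.conj_im] at h2
  have hS' : S = S.im * Complex.I := by apply Complex.ext <;> simp [hre]
  rw [hS', norm_mul, Complex.norm_I, mul_one, Complex.norm_real, Real.norm_eq_abs, abs_le]
  constructor <;> linarith

/-- `expi t = exp (2 π i t)`. -/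
noncomputable def expi (t : ℝ) : ℂ := Complex.exp (2 * Real.pi * t * Complex.I)

theorem expi_add (s t : ℝ) : expi (s + t) = expi s * expi t := by
  rw [expi, expi, expi, ← Complex.exp_add]; congr 1; push_cast; ring

theorem expi_zero : expi 0 = 1 := by simp [expi]

theorem norm_expi (t : ℝ) : ‖expi t‖ = 1 := by
  have : expi t = Complex.exp ((2 * Real.pi * t : ℝ) * Complex.I) := by rw [expi]; push_cast; rfl
  rw [this, Complex.norm_exp_ofReal_mul_I]

theorem star_expi (t : ℝ) : star (expi t) = expi (-t) := by
  rw [expi, expi, Complex.star_def, ← Complex.exp_conj]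
  congr 1
  simp [Complex.conj_ofNat]

theorem expi_int (p : ℤ) : expi p = 1 := by
  rw [expi, Complex.exp_eq_one_iff]
  exact ⟨p, by push_cast; ring⟩

theorem expi_eq_one_iff (t : ℝ) : expi t = 1 ↔ ∃ p : ℤ, t = p := by
  constructor
  · intro h
    rw [expi, Complex.exp_eq_one_iff] at h
    obtain ⟨p, hp⟩ := h
    refine ⟨p, ?_⟩
    have h1 : (2 * Real.pi * Complex.I : ℂ) ≠ 0 := Complex.two_pi_I_ne_zero
    have h2 : (t : ℂ) = p := by
      apply mul_left_cancel₀ h1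
      linear_combination hp
    exact_mod_cast h2
  · rintro ⟨p, rfl⟩; exact expi_int p

theorem expi_neg_half_sub_expi_half (s : ℝ) :
    expi (-(s / 2)) - expi (s / 2) = -2 * Complex.I * (Real.sin (Real.pi * s) : ℂ) := by
  have h1 : (2 * Real.pi * ((-(s / 2) : ℝ) : ℂ) * Complex.I) = -((Real.pi * s : ℝ) : ℂ) * Complex.I := by
    push_cast; ring
  have h2 : (2 * Real.pi * ((s / 2 : ℝ) : ℂ) * Complex.I) = ((Real.pi * s : ℝ) : ℂ) * Complex.I := by
    push_cast; ring
  rw [expi, expi, h1, h2, Complex.ofReal_sin, Complex.sin]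
  linear_combination (Complex.exp (-((Real.pi * s : ℝ) : ℂ) * Complex.I) -
    Complex.exp (((Real.pi * s : ℝ) : ℂ) * Complex.I)) * Complex.I_mul_I

theorem summation_by_parts_expi (c : ℕ → ℝ) (Q : ℕ) (h0 : c 0 = 0) (hQ : c Q = 0) (s : ℝ) :
    (expi (-(s / 2)) - expi (s / 2)) * ∑ i ∈ Finset.range Q, (c i : ℂ) * expi (i * s) =
      ∑ i ∈ Finset.range Q, ((c (i + 1) - c i : ℝ) : ℂ) * expi ((i + 1 / 2) * s) := by
  have ht : ∀ i : ℕ, ((c (i + 1) - c i : ℝ) : ℂ) * expi ((i + 1 / 2) * s) =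
      ((c (i + 1) : ℂ) * expi ((i + 1 : ℕ) * s) * expi (-(s / 2)) -
        (c i : ℂ) * expi (i * s) * expi (-(s / 2))) +
      (expi (-(s / 2)) - expi (s / 2)) * ((c i : ℂ) * expi (i * s)) := by
    intro i
    have e1 : expi ((i + 1 / 2) * s) = expi (i * s) * expi (s / 2) := by
      rw [← expi_add]; congr 1; ring
    have e2 : expi ((i + 1 / 2) * s) = expi ((i + 1 : ℕ) * s) * expi (-(s / 2)) := by
      rw [← expi_add]; congr 1; push_cast; ring
    push_cast at e1 e2 ⊢
    linear_combination (c (i + 1) : ℂ) * e2 - (c i : ℂ) * e1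
  simp_rw [ht]
  rw [Finset.sum_add_distrib,
    Finset.sum_range_sub (fun i : ℕ => (c i : ℂ) * expi (i * s) * expi (-(s / 2))), Finset.mul_sum]
  simp [h0, hQ]

theorem CircleSeparated.sum_mul_expi {ι : Type*} [DecidableEq ι] {ε : ℝ} (hε : 0 < ε) {y : ι → ℝ}
    (hy : CircleSeparated ε y) (c : ℕ → ℝ) (Q : ℕ) (h0 : c 0 = 0) (hQ : c Q = 0) (j k : ι) :
    ∑ i ∈ Finset.range Q, (c i : ℂ) * expi (i * (y j - y k)) =
      (if j = k then ∑ i ∈ Finset.range Q, (c i : ℂ) else 0) +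
      Complex.I / 2 * (cscEntry y j k : ℂ) *
        ∑ i ∈ Finset.range Q, ((c (i + 1) - c i : ℝ) : ℂ) * expi ((i + 1 / 2) * (y j - y k)) := by
  by_cases h : j = k
  · subst h
    simp [cscEntry_self, expi_zero]
  · rw [if_neg h, ← summation_by_parts_expi c Q h0 hQ, expi_neg_half_sub_expi_half, cscEntry]
    have hs := hy.sin_ne_zero hε h
    have hs' : (Real.sin (Real.pi * (y j - y k)) : ℂ) ≠ 0 := by exact_mod_cast hs
    rw [Complex.ofReal_inv]
    set S := ∑ i ∈ Finset.range Q, (c i : ℂ) * expi (i * (y j - y k))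
    linear_combination S * Complex.I_sq + Complex.I ^ 2 * S * inv_mul_cancel₀ hs'

theorem normSq_sum_eq {ι : Type*} [Fintype ι] (z : ι → ℂ) :
    ((‖∑ j, z j‖ ^ 2 : ℝ) : ℂ) = ∑ j, ∑ k, z j * star (z k) := by
  rw [← Finset.sum_mul_sum, ← star_sum, Complex.star_def, Complex.mul_conj,
    Complex.normSq_eq_norm_sq]

theorem CircleSeparated.abs_weighted_sum_sub_le {ι : Type*} [Fintype ι] {ε : ℝ} (hε : 0 < ε)
    {y : ι → ℝ} (hy : CircleSeparated ε y) (c : ℕ → ℝ) (Q : ℕ) (h0 : c 0 = 0) (hQ : c Q = 0)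
    (b : ι → ℂ) :
    |∑ i ∈ Finset.range Q, c i * ‖∑ j, b j * expi (i * y j)‖ ^ 2 -
      (∑ i ∈ Finset.range Q, c i) * ∑ j, ‖b j‖ ^ 2| ≤
      1 / 2 * (∑ i ∈ Finset.range Q, |c (i + 1) - c i|) * (ε⁻¹ * ∑ j, ‖b j‖ ^ 2) := by
  classical
  have key : ((∑ i ∈ Finset.range Q, c i * ‖∑ j, b j * expi (i * y j)‖ ^ 2 -
      (∑ i ∈ Finset.range Q, c i) * ∑ j, ‖b j‖ ^ 2 : ℝ) : ℂ) =
      Complex.I / 2 * ∑ i ∈ Finset.range Q, ((c (i + 1) - c i : ℝ) : ℂ) *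
        ∑ j, ∑ k, (b j * expi ((i + 1 / 2) * y j)) * star (b k * expi ((i + 1 / 2) * y k)) *
          (cscEntry y j k : ℂ) := by
    have hexp : ∀ (t : ℝ) (j k : ι), b j * expi (t * y j) * star (b k * expi (t * y k)) =
        b j * star (b k) * expi (t * (y j - y k)) := by
      intro t j k
      rw [star_mul', star_expi, mul_sub, sub_eq_add_neg, expi_add]; ring
    have e1 : ((∑ i ∈ Finset.range Q, c i * ‖∑ j, b j * expi (i * y j)‖ ^ 2 : ℝ) : ℂ) =
        ∑ j, ∑ k, b j * star (b k) *
          ∑ i ∈ Finset.range Q, (c i : ℂ) * expi (i * (y j - y k)) := by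
      simp_rw [Finset.mul_sum]
      rw [Complex.ofReal_sum]
      calc _ = ∑ i ∈ Finset.range Q, ∑ j, ∑ k, b j * star (b k) *
              ((c i : ℂ) * expi (i * (y j - y k))) := by
            refine Finset.sum_congr rfl fun i _ => ?_
            rw [Complex.ofReal_mul, normSq_sum_eq, Finset.mul_sum]
            refine Finset.sum_congr rfl fun j _ => ?_
            rw [Finset.mul_sum]
            refine Finset.sum_congr rfl fun k _ => ?_
            rw [hexp]; ring
        _ = _ := by
            rw [Finset.sum_comm]
            refine Finset.sum_congr rfl fun j _ => ?_
            rw [Finset.sum_comm]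
    have e2 : ∑ j, ∑ k, b j * star (b k) * (if j = k then ∑ i ∈ Finset.range Q, (c i : ℂ) else 0) =
        (((∑ i ∈ Finset.range Q, c i) * ∑ j, ‖b j‖ ^ 2 : ℝ) : ℂ) := by
      simp only [mul_ite, mul_zero, Finset.sum_ite_eq, Finset.mem_univ, if_true]
      rw [← Finset.sum_mul, Complex.ofReal_mul, Complex.ofReal_sum, Complex.ofReal_sum, mul_comm]
      congr 1
      refine Finset.sum_congr rfl fun j _ => ?_
      rw [← Complex.normSq_eq_norm_sq, ← Complex.mul_conj, Complex.star_def]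
    have e3 : ∑ j, ∑ k, b j * star (b k) * (Complex.I / 2 * (cscEntry y j k : ℂ) *
        ∑ i ∈ Finset.range Q, ((c (i + 1) - c i : ℝ) : ℂ) * expi ((i + 1 / 2) * (y j - y k))) =
        Complex.I / 2 * ∑ i ∈ Finset.range Q, ((c (i + 1) - c i : ℝ) : ℂ) *
        ∑ j, ∑ k, (b j * expi ((i + 1 / 2) * y j)) * star (b k * expi ((i + 1 / 2) * y k)) *
          (cscEntry y j k : ℂ) := by
      simp_rw [hexp, Finset.mul_sum]
      symm
      rw [Finset.sum_comm]
      refine Finset.sum_congr rfl fun j _ => ?_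
      rw [Finset.sum_comm]
      refine Finset.sum_congr rfl fun k _ => Finset.sum_congr rfl fun i _ => ?_
      ring
    rw [Complex.ofReal_sub, e1]
    simp_rw [hy.sum_mul_expi hε c Q h0 hQ, mul_add, Finset.sum_add_distrib]
    rw [e2, e3]
    ring
  rw [← Real.norm_eq_abs, ← Complex.norm_real, key, norm_mul, norm_div, Complex.norm_I,
    Complex.norm_two, mul_assoc]
  gcongr
  rw [Finset.sum_mul]
  refine (norm_sum_le _ _).trans (Finset.sum_le_sum fun i _ => ?_)
  rw [norm_mul, Complex.norm_real, Real.norm_eq_abs]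
  gcongr
  refine (hy.norm_cscForm_le hε _).trans_eq ?_
  simp [norm_expi]

/-- The points `(x j + k) / K`, `k < K`. -/
noncomputable def refinement {ι : Type*} (K : ℕ) (x : ι → ℝ) (jk : ι × Fin K) : ℝ :=
  (x jk.1 + (jk.2 : ℕ)) / K

theorem CircleSeparated.refinement {ι : Type*} {D : ℝ} (hD : D ≤ 1) {x : ι → ℝ}
    (hx : CircleSeparated D x) {K : ℕ} (hK : 0 < K) :
    CircleSeparated (D / K) (refinement K x) := by
  rintro ⟨j, k⟩ ⟨j', k'⟩ hne p
  have hK' : (0 : ℝ) < K := by exact_mod_cast hK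
  have e : SpikeDeconv.refinement K x (j, k) - SpikeDeconv.refinement K x (j', k') + p =
      (x j - x j' + (((k : ℕ) : ℤ) - ((k' : ℕ) : ℤ) + p * K : ℤ)) / K := by
    simp only [SpikeDeconv.refinement]
    push_cast
    field_simp
    ring
  rw [e, abs_div, abs_of_pos hK']
  gcongr
  by_cases hj : j = j'
  · subst hj
    rw [sub_self, zero_add]
    have hz : (((k : ℕ) : ℤ) - ((k' : ℕ) : ℤ) + p * K : ℤ) ≠ 0 := by
      intro h
      apply hne
      have hk : ((k : ℕ) : ℤ) < K := by exact_mod_cast k.2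
      have hk' : ((k' : ℕ) : ℤ) < K := by exact_mod_cast k'.2
      have hp : p = 0 := by
        by_contra hp
        rcases lt_or_gt_of_ne hp with h1 | h1 <;> nlinarith
      subst hp
      have : (k : ℕ) = k' := by omega
      rw [Fin.ext this]
    refine hD.trans ?_
    rw [← Int.cast_abs]
    exact_mod_cast Int.one_le_abs hz
  · exact hx j j' hj _

theorem sum_expi_refinement {K : ℕ} (hK : 0 < K) (i : ℕ) :
    ∑ k : Fin K, expi (i * (k : ℕ) / K) = if K ∣ i then (K : ℂ) else 0 := by
  have hK' : (K : ℝ) ≠ 0 := by exact_mod_cast hK.ne'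
  have hpow : ∀ k : ℕ, expi (i * k / K) = expi (i / K) ^ k := by
    intro k
    induction k with
    | zero => simp [expi_zero]
    | succ k ih =>
      rw [pow_succ, ← ih, ← expi_add]; congr 1; push_cast; ring
  have h1 : ∑ k : Fin K, expi (i * (k : ℕ) / K) = ∑ k ∈ Finset.range K, expi (i / K) ^ k := by
    rw [Finset.sum_range]
    exact Finset.sum_congr rfl fun k _ => hpow k
  rw [h1]
  have hdvd : expi (i / K) = 1 ↔ K ∣ i := by
    rw [expi_eq_one_iff]
    constructor
    · rintro ⟨p, hp⟩
      rw [div_eq_iff hK'] at hp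
      have : (i : ℤ) = K * p := by
        have : (i : ℝ) = K * p := by rw [hp]; ring
        exact_mod_cast this
      exact Int.natCast_dvd_natCast.1 ⟨p, this⟩
    · rintro ⟨q, rfl⟩
      refine ⟨q, ?_⟩
      push_cast
      field_simp
  split_ifs with h
  · rw [hdvd.2 h]; simp
  · have hne : expi (i / K) ≠ 1 := fun h' => h (hdvd.1 h')
    rw [geom_sum_eq hne, ← hpow]
    have : (i * K / K : ℝ) = ((i : ℤ) : ℝ) := by field_simp; simp
    rw [this, expi_int]; simp

theorem sum_range_mul_of_dvd {f : ℕ → ℝ} {K : ℕ} (hK : 0 < K) (hf : ∀ i, ¬ K ∣ i → f i = 0)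
    (P : ℕ) : ∑ i ∈ Finset.range (P * K), f i = ∑ q ∈ Finset.range P, f (q * K) := by
  induction P with
  | zero => simp
  | succ P ih =>
    rw [Nat.succ_mul, Finset.sum_range_add, ih, Finset.sum_range_succ]
    congr 1
    rw [Finset.sum_eq_single 0]
    · simp
    · intro s hs hs0
      apply hf
      rw [Nat.dvd_add_right (Dvd.intro_left P rfl)]
      exact Nat.not_dvd_of_pos_of_lt (Nat.pos_of_ne_zero hs0) (Finset.mem_range.1 hs)
    · intro h; exact absurd (Finset.mem_range.2 hK) h

/-- Sampling inequality with the Riemann sum of mesh `1 / K` in place of the integral. -/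
theorem CircleSeparated.abs_sampling_sub_riemann_le {ι : Type*} [Fintype ι] {D : ℝ} (hD0 : 0 < D)
    (hD : D ≤ 1) {x : ι → ℝ} (hx : CircleSeparated D x) {K : ℕ} (hK : 0 < K) (P : ℕ)
    {F : ℝ → ℝ} (h0 : F 0 = 0) (hP : F P = 0) (a : ι → ℂ) :
    |∑ q ∈ Finset.range P, F q * ‖∑ j, a j * expi (q * x j)‖ ^ 2 -
      ((∑ i ∈ Finset.range (P * K), F (i / K)) / K) * ∑ j, ‖a j‖ ^ 2| ≤
      1 / 2 * (∑ i ∈ Finset.range (P * K), |F ((i + 1 : ℕ) / K) - F (i / K)|) *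
        (D⁻¹ * ∑ j, ‖a j‖ ^ 2) := by
  have hK' : (0 : ℝ) < K := by exact_mod_cast hK
  have h := (hx.refinement hD hK).abs_weighted_sum_sub_le (div_pos hD0 hK')
    (fun i : ℕ => F (i / K)) (P * K) (by simpa using h0) (by
      push_cast; rw [mul_div_cancel_right₀ _ hK'.ne']; exact hP) (fun jk => a jk.1)
  have hb : ∑ jk : ι × Fin K, ‖a jk.1‖ ^ 2 = K * ∑ j, ‖a j‖ ^ 2 := by
    rw [Fintype.sum_prod_type, Finset.mul_sum]
    simp
  have hin : ∀ i : ℕ, ∑ jk : ι × Fin K, a jk.1 * expi (i * SpikeDeconv.refinement K x jk) =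
      (∑ j, a j * expi (i * x j / K)) * if K ∣ i then (K : ℂ) else 0 := by
    intro i
    rw [Fintype.sum_prod_type, Finset.sum_mul]
    refine Finset.sum_congr rfl fun j _ => ?_
    rw [← sum_expi_refinement hK, Finset.mul_sum]
    refine Finset.sum_congr rfl fun k _ => ?_
    rw [mul_assoc, ← expi_add]
    congr 2
    simp only [SpikeDeconv.refinement]
    ring
  have hsum : ∑ i ∈ Finset.range (P * K), F (i / K) *
      ‖∑ jk : ι × Fin K, a jk.1 * expi (i * SpikeDeconv.refinement K x jk)‖ ^ 2 =
      K ^ 2 * ∑ q ∈ Finset.range P, F q * ‖∑ j, a j * expi (q * x j)‖ ^ 2 := by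
    rw [sum_range_mul_of_dvd hK, Finset.mul_sum]
    · refine Finset.sum_congr rfl fun q _ => ?_
      rw [hin, if_pos (Dvd.intro_left q rfl), norm_mul, mul_pow, Complex.norm_natCast]
      push_cast
      have e : ∀ t : ℝ, (q * K * t / K : ℝ) = q * t := fun t => by field_simp
      simp_rw [e]
      rw [mul_div_cancel_right₀ _ hK'.ne']; ring
    · intro i hi
      rw [hin, if_neg hi]; simp
  simp only [hb, hsum] at h
  set S1 := ∑ q ∈ Finset.range P, F q * ‖∑ j, a j * expi (q * x j)‖ ^ 2
  set R := ∑ i ∈ Finset.range (P * K), F (i / K)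
  set V := ∑ i ∈ Finset.range (P * K), |F ((i + 1 : ℕ) / K) - F (i / K)|
  set A := ∑ j, ‖a j‖ ^ 2
  have e1 : K ^ 2 * S1 - R * (K * A) = (K : ℝ) ^ 2 * (S1 - R / K * A) := by field_simp
  have e2 : 1 / 2 * V * ((D / K)⁻¹ * (K * A)) = (K : ℝ) ^ 2 * (1 / 2 * V * (D⁻¹ * A)) := by
    field_simp
  rw [e1, e2, abs_mul, abs_of_pos (by positivity : (0 : ℝ) < K ^ 2)] at h
  exact le_of_mul_le_mul_left h (by positivity)

theorem _root_.BoundedVariationOn.abs_riemann_sub_integral_le {F : ℝ → ℝ}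
    (hF : BoundedVariationOn F Set.univ) (P : ℕ) (hint : IntervalIntegrable F volume 0 P) {K : ℕ}
    (hK : 0 < K) :
    |(∑ i ∈ Finset.range (P * K), F (i / K)) / K - ∫ t in (0 : ℝ)..P, F t| ≤
      (eVariationOn F Set.univ).toReal / K := by
  have hK' : (0 : ℝ) < K := by exact_mod_cast hK
  set I : ℕ → ℝ := fun i => (i : ℝ) / K with hI
  have hmono : Monotone I := fun a b h => by
    simp only [hI]; gcongr
  have hI0 : I 0 = 0 := by simp [hI]
  have hIP : I (P * K) = P := by simp only [hI]; push_cast; field_simp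
  have hlen : ∀ i, I (i + 1) - I i = 1 / K := fun i => by simp only [hI]; push_cast; ring
  have hfin : ∀ s, eVariationOn F s ≠ ⊤ := fun s => hF.mono (Set.subset_univ s)
  have hsub : ∀ i < P * K, IntervalIntegrable F volume (I i) (I (i + 1)) := by
    intro i hi
    refine hint.mono_set ?_
    rw [← hI0, ← hIP, Set.uIcc_of_le (hmono (Nat.le_succ i)), Set.uIcc_of_le (hmono (Nat.zero_le _))]
    exact Set.Icc_subset_Icc (hmono (Nat.zero_le _)) (hmono hi)
  have hsplit : ∫ t in (0 : ℝ)..P, F t = ∑ i ∈ Finset.range (P * K), ∫ t in I i..I (i + 1), F t := by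
    rw [intervalIntegral.sum_integral_adjacent_intervals hsub, hI0, hIP]
  have hcell : ∀ i ∈ Finset.range (P * K), |F (I i) / K - ∫ t in I i..I (i + 1), F t| ≤
      (eVariationOn F (Set.Icc (I i) (I (i + 1)))).toReal / K := by
    intro i hi
    have e : F (I i) / K - ∫ t in I i..I (i + 1), F t = ∫ t in I i..I (i + 1), (F (I i) - F t) := by
      rw [intervalIntegral.integral_sub (by simp) (hsub i (Finset.mem_range.1 hi)),
        intervalIntegral.integral_const, hlen, smul_eq_mul]
      ring
    rw [e, ← Real.norm_eq_abs]
    refine (intervalIntegral.norm_integral_le_of_norm_le_const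
      (C := (eVariationOn F (Set.Icc (I i) (I (i + 1)))).toReal) ?_).trans_eq ?_
    · intro t ht
      rw [Set.uIoc_of_le (hmono (Nat.le_succ i))] at ht
      rw [← dist_eq_norm]
      exact BoundedVariationOn.dist_le (hfin _) (Set.left_mem_Icc.2 (hmono (Nat.le_succ i)))
        ⟨ht.1.le, ht.2⟩
    · rw [hlen, abs_of_pos (by positivity)]; ring
  rw [hsplit, Finset.sum_div, ← Finset.sum_sub_distrib]
  refine (Finset.abs_sum_le_sum_abs _ _).trans ((Finset.sum_le_sum hcell).trans ?_)
  rw [← Finset.sum_div, ← ENNReal.toReal_sum (fun i _ => hfin _), eVariationOn.sum' F hmono]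
  exact div_le_div_of_nonneg_right
    (ENNReal.toReal_mono hF (eVariationOn.mono F (Set.subset_univ _))) hK'.le

theorem _root_.BoundedVariationOn.sum_abs_sub_le {F : ℝ → ℝ} (hF : BoundedVariationOn F Set.univ)
    {u : ℕ → ℝ} (hu : Monotone u) (n : ℕ) :
    ∑ i ∈ Finset.range n, |F (u (i + 1)) - F (u i)| ≤ (eVariationOn F Set.univ).toReal := by
  have h := eVariationOn.sum_le (f := F) (s := Set.univ) (n := n) hu (fun _ => Set.mem_univ _)
  have h2 := ENNReal.toReal_mono hF h
  rw [ENNReal.toReal_sum (fun i _ => edist_ne_top _ _)] at h2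
  simpa only [edist_dist, ENNReal.toReal_ofReal, dist_nonneg, Real.dist_eq, abs_nonneg] using h2

/-- A large sieve inequality weighted by a function of bounded variation. -/
theorem CircleSeparated.abs_sampling_sub_integral_le {ι : Type*} [Fintype ι] {D : ℝ} (hD0 : 0 < D)
    (hD : D ≤ 1) {x : ι → ℝ} (hx : CircleSeparated D x) (P : ℕ)
    {F : ℝ → ℝ} (hF : BoundedVariationOn F Set.univ) (hint : IntervalIntegrable F volume 0 P)
    (h0 : F 0 = 0) (hP : F P = 0) (a : ι → ℂ) :
    |∑ q ∈ Finset.range P, F q * ‖∑ j, a j * expi (q * x j)‖ ^ 2 -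
      (∫ t in (0 : ℝ)..P, F t) * ∑ j, ‖a j‖ ^ 2| ≤
      1 / 2 * (eVariationOn F Set.univ).toReal * (D⁻¹ * ∑ j, ‖a j‖ ^ 2) := by
  set S := ∑ q ∈ Finset.range P, F q * ‖∑ j, a j * expi (q * x j)‖ ^ 2
  set A := ∑ j, ‖a j‖ ^ 2
  set V := (eVariationOn F Set.univ).toReal
  have hA : 0 ≤ A := Finset.sum_nonneg fun _ _ => by positivity
  have hbound : ∀ m : ℕ, |S - (∫ t in (0 : ℝ)..P, F t) * A| ≤
      1 / 2 * V * (D⁻¹ * A) + V * A * (1 / ((m : ℝ) + 1)) := by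
    intro m
    have h1 := hx.abs_sampling_sub_riemann_le hD0 hD (Nat.succ_pos m) P h0 hP a
    have h2 := hF.abs_riemann_sub_integral_le P hint (Nat.succ_pos m)
    have h3 := hF.sum_abs_sub_le (u := fun i : ℕ => (i : ℝ) / (m + 1 : ℕ))
      (fun a b h => by dsimp only; gcongr) (P * (m + 1))
    set R := (∑ i ∈ Finset.range (P * (m + 1)), F (i / (m + 1 : ℕ))) / (m + 1 : ℕ)
    calc |S - (∫ t in (0 : ℝ)..P, F t) * A| = |(S - R * A) + (R - ∫ t in (0 : ℝ)..P, F t) * A| := by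
          congr 1; ring
      _ ≤ |S - R * A| + |(R - ∫ t in (0 : ℝ)..P, F t) * A| := abs_add_le _ _
      _ ≤ 1 / 2 * V * (D⁻¹ * A) + V / (m + 1 : ℕ) * A := by
          rw [abs_mul, abs_of_nonneg hA]
          gcongr
          exact h1.trans (by gcongr)
      _ = _ := by push_cast; ring
  refine ge_of_tendsto' (x := Filter.atTop) ?_ hbound
  simpa using! (tendsto_one_div_add_atTop_nhds_zero_nat (𝕜 := ℝ)).const_mul (V * A) |>.const_add
    (1 / 2 * V * (D⁻¹ * A))

theorem bandEnergy_nonneg (T : ℝ) (n : ℕ) (h : ℝ → ℂ) : 0 ≤ bandEnergy T n h :=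
  integral_nonneg fun _ => by positivity

/-- The quadratic form of the weighted Vandermonde matrix is close to `T` times the band energy. -/
theorem abs_weighted_vandermonde_sub_le {r : ℕ} {T : ℝ} (hT : 0 < T) (n : ℕ) {h : ℝ → ℂ}
    (hc : Continuous h) (hV : bandVariation T n h ≠ ⊤) {τ : Fin r → ℝ} {D : ℝ} (hD0 : 0 < D)
    (hDT : D ≤ T) (hτ : ∀ j k, j ≠ k → ∀ p : ℤ, D ≤ |τ j - τ k + p * T|) (a : Fin r → ℂ) :
    |∑ u, ‖h (freq T n u) * ∑ j, vandermonde T n τ u j * a j‖ ^ 2 -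
      T * bandEnergy T n h * ∑ j, ‖a j‖ ^ 2| ≤
      T * (1 / 2 * (bandVariation T n h).toReal * D⁻¹) * ∑ j, ‖a j‖ ^ 2 := by
  have hT0 : T ≠ 0 := hT.ne'
  set G : ℝ → ℝ := (band T n).indicator fun f => ‖h f‖ ^ 2 with hG
  set φ : ℝ → ℝ := fun t => t / T - (n + 1) / T with hφ
  set F : ℝ → ℝ := fun t => G (φ t) with hF
  have hφm : Monotone φ := fun a b hab => by simp only [hφ]; gcongr
  have hFv : eVariationOn F Set.univ ≤ bandVariation T n h :=
    eVariationOn.comp_le_of_monotoneOn G φ (hφm.monotoneOn _) fun _ _ => Set.mem_univ _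
  have hband : ∀ t, φ t ∈ band T n ↔ 1 / 2 ≤ t ∧ t ≤ 2 * n + 3 / 2 := by
    intro t
    have e : φ t = (t - (n + 1)) / T := by simp only [hφ]; ring
    have e2 : (2 * n + 1 : ℝ) / (2 * T) = (n + 1 / 2) / T := by field_simp
    rw [band, Set.mem_Icc, e, e2, ← neg_div, div_le_div_iff_of_pos_right hT,
      div_le_div_iff_of_pos_right hT]
    constructor <;> rintro ⟨h1, h2⟩ <;> constructor <;> linarith
  have hGint : Integrable G := by
    rw [hG, band, integrable_indicator_iff measurableSet_Icc]
    exact (by fun_prop : Continuous fun f => ‖h f‖ ^ 2).continuousOn.integrableOn_Icc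
  have hF0 : F 0 = 0 := Set.indicator_of_notMem (by rw [hband]; norm_num) _
  have hFP : F (2 * n + 2 : ℕ) = 0 := Set.indicator_of_notMem (by
    rw [hband]; push_cast; intro h; linarith [h.2]) _
  have hFint : Integrable F := by
    have h1 := (hGint.comp_sub_right ((n + 1) / T)).comp_div hT0
    exact h1
  have hE : ∫ t in (0 : ℝ)..(2 * n + 2 : ℕ), F t = T * bandEnergy T n h := by
    have h1 : ∫ t in (0 : ℝ)..(2 * n + 2 : ℕ), F t = ∫ t, F t := by
      rw [intervalIntegral.integral_of_le (by positivity)]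
      refine setIntegral_eq_integral_of_forall_compl_eq_zero fun t ht => ?_
      refine Set.indicator_of_notMem (fun hm => ht ?_) _
      rw [hband] at hm
      push_cast
      constructor <;> linarith [hm.1, hm.2]
    rw [h1, hF]
    have h2 := Measure.integral_comp_div (fun s => G (s - (n + 1) / T)) T
    rw [integral_sub_right_eq_self, abs_of_pos hT, smul_eq_mul] at h2
    rw [h2, hG, bandEnergy, band, integral_indicator measurableSet_Icc]
  set x : Fin r → ℝ := fun j => -(τ j / T) with hx
  have hsep : CircleSeparated (D / T) x := by
    intro j k hjk p
    have := hτ j k hjk (-p)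
    have e : x j - x k + p = -((τ j - τ k + (-p : ℤ) * T) / T) := by
      simp only [hx]; push_cast; field_simp; ring
    rw [e, abs_neg, abs_div, abs_of_pos hT]
    gcongr
  set b : Fin r → ℂ := fun j => a j * expi ((n + 1) * (τ j / T)) with hb
  have key := hsep.abs_sampling_sub_integral_le (by positivity) ((div_le_one hT).2 hDT)
    (2 * n + 2) (ne_top_of_le_ne_top hV hFv) hFint.intervalIntegrable hF0 hFP b
  have hbn : ∑ j, ‖b j‖ ^ 2 = ∑ j, ‖a j‖ ^ 2 := by simp [hb, norm_expi]
  have hterm : ∀ q : ℕ, ∀ u : Fin (2 * n + 1), q = u + 1 →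
      F q * ‖∑ j, b j * expi (q * x j)‖ ^ 2 =
      ‖h (freq T n u) * ∑ j, vandermonde T n τ u j * a j‖ ^ 2 := by
    rintro q u rfl
    have hu : ((u : ℕ) : ℝ) ≤ 2 * n := by exact_mod_cast Nat.lt_succ_iff.1 u.2
    have hu0 : (0 : ℝ) ≤ ((u : ℕ) : ℝ) := by positivity
    have e1 : φ ((u : ℕ) + 1 : ℕ) = freq T n u := by
      simp only [hφ, freq]; push_cast; ring
    have e2 : F ((u : ℕ) + 1 : ℕ) = ‖h (freq T n u)‖ ^ 2 := by
      simp only [hF]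
      rw [hG, Set.indicator_of_mem, e1]
      rw [hband]; push_cast
      constructor <;> linarith
    rw [e2, norm_mul, mul_pow]
    congr 3
    refine Finset.sum_congr rfl fun j _ => ?_
    rw [hb, mul_assoc, ← expi_add, mul_comm]
    congr 1
    rw [vandermonde, Matrix.of_apply, expi]
    congr 1
    simp only [hx, freq]
    push_cast
    have : (T : ℂ) ≠ 0 := by exact_mod_cast hT0
    field_simp
    ring
  have hsum : ∑ q ∈ Finset.range (2 * n + 2), F q * ‖∑ j, b j * expi (q * x j)‖ ^ 2 =
      ∑ u, ‖h (freq T n u) * ∑ j, vandermonde T n τ u j * a j‖ ^ 2 := by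
    rw [Finset.sum_range_succ', Nat.cast_zero, hF0, zero_mul, add_zero, Finset.sum_range]
    exact Finset.sum_congr rfl fun u _ => hterm _ u rfl
  rw [hsum, hE, hbn] at key
  refine key.trans ?_
  have hA : 0 ≤ ∑ j, ‖a j‖ ^ 2 := Finset.sum_nonneg fun _ _ => by positivity
  calc 1 / 2 * (eVariationOn F Set.univ).toReal * ((D / T)⁻¹ * ∑ j, ‖a j‖ ^ 2)
      ≤ 1 / 2 * (bandVariation T n h).toReal * ((D / T)⁻¹ * ∑ j, ‖a j‖ ^ 2) := by
        gcongr
    _ = _ := by rw [inv_div]; ring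

theorem continuous_fourier {g : ℝ → ℂ} (hg : Integrable g) : Continuous (𝓕 g) :=
  VectorFourier.fourierIntegral_continuous (L := innerₗ ℝ) Real.continuous_fourierChar
    continuous_inner hg

theorem continuous_derivSpectrum {g : ℝ → ℂ} (hg : Integrable g) :
    Continuous (derivSpectrum g) := by
  have := continuous_fourier hg
  unfold derivSpectrum
  fun_prop

theorem norm_sq_derivSpectrum (g : ℝ → ℂ) (f : ℝ) :
    ‖derivSpectrum g f‖ ^ 2 = (2 * Real.pi * f) * (2 * Real.pi * f) * ‖𝓕 g f‖ ^ 2 := by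
  rw [derivSpectrum, norm_mul, norm_mul, norm_mul, norm_mul, Complex.norm_I, Complex.norm_two,
    Complex.norm_real, Complex.norm_real, Real.norm_eq_abs, Real.norm_eq_abs, mul_pow, mul_pow,
    mul_pow, mul_pow, sq_abs, sq_abs]
  ring

theorem bandVariation_derivSpectrum_ne_top {T : ℝ} {n : ℕ} {g : ℝ → ℂ}
    (hV : bandVariation T n (𝓕 g) ≠ ⊤) : bandVariation T n (derivSpectrum g) ≠ ⊤ := by
  set B : ℝ := (2 * n + 1 : ℝ) / (2 * T) with hB
  set q : ℝ → ℝ := fun f => 2 * Real.pi * max (-|B|) (min |B| f) with hq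
  have hp := Real.pi_pos
  have hqv : BoundedVariationOn q Set.univ := by
    refine MonotoneOn.boundedVariationOn (C := 2 * Real.pi * |B|) ?_ ?_
    · intro a _ b _ hab
      simp only [hq]; gcongr
    · intro x _
      simp only [hq]
      rw [abs_mul, abs_of_pos (by positivity : 0 < 2 * Real.pi)]
      refine mul_le_mul_of_nonneg_left ?_ (by positivity)
      rw [abs_le]
      exact ⟨le_max_left _ _, max_le (by linarith [abs_nonneg B]) (min_le_left _ _)⟩
  have h := (hqv.mul hqv).mul hV
  have e : (band T n).indicator (fun f => ‖derivSpectrum g f‖ ^ 2) =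
      q * q * (band T n).indicator fun f => ‖𝓕 g f‖ ^ 2 := by
    funext f
    by_cases hf : f ∈ band T n
    · have h1 : -B ≤ f ∧ f ≤ B := hf
      have h2 : B ≤ |B| := le_abs_self B
      have e1 : q f = 2 * Real.pi * f := by
        simp only [hq]
        rw [min_eq_right (by linarith), max_eq_right (by linarith)]
      rw [Pi.mul_apply, Pi.mul_apply, Set.indicator_of_mem hf, Set.indicator_of_mem hf, e1,
        norm_sq_derivSpectrum]
    · rw [Pi.mul_apply, Set.indicator_of_notMem hf, Set.indicator_of_notMem hf, mul_zero]
  rw [bandVariation, e]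
  exact h

theorem bandEnergy_derivSpectrum_ne_zero {T : ℝ} {n : ℕ} {g : ℝ → ℂ} (hg : Integrable g)
    (hE : bandEnergy T n (𝓕 g) ≠ 0) : bandEnergy T n (derivSpectrum g) ≠ 0 := by
  intro h0
  apply hE
  have hc := continuous_derivSpectrum hg
  rw [bandEnergy, setIntegral_eq_zero_iff_of_nonneg_ae
    (Filter.Eventually.of_forall fun _ => by positivity)] at h0
  · refine integral_eq_zero_of_ae ?_
    have hne : ∀ᵐ f ∂(volume.restrict (band T n)), f ≠ 0 :=
      ae_restrict_of_ae (by simp [ae_iff])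
    filter_upwards [h0, hne] with f hf hf0
    rw [norm_sq_derivSpectrum] at hf
    have hp := Real.pi_ne_zero
    simpa [hp, hf0] using hf
  · exact (by fun_prop : Continuous fun f => ‖derivSpectrum g f‖ ^ 2).continuousOn.integrableOn_Icc

theorem bandEnergy_mul_flatness {T : ℝ} {n : ℕ} {h : ℝ → ℂ} (hE : bandEnergy T n h ≠ 0) :
    bandEnergy T n h * flatness T n h = (bandVariation T n h).toReal := by
  rw [flatness, mul_inv_cancel_left₀ hE]

theorem separation_le {r : ℕ} (T : ℝ) (τ : Fin r → ℝ) {j k : Fin r} (h : j ≠ k) (p : ℤ) :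
    separation T τ ≤ |τ j - τ k + p * T| :=
  csInf_le ⟨0, by rintro _ ⟨_, _, _, _, rfl⟩; exact abs_nonneg _⟩ ⟨j, k, p, h, rfl⟩

theorem separation_le_period {r : ℕ} (hr : 2 ≤ r) {T : ℝ} (hT : 0 < T) (τ : Fin r → ℝ) :
    separation T τ ≤ T := by
  set t := τ ⟨0, by omega⟩ - τ ⟨1, by omega⟩ with ht
  have h := separation_le T τ (j := ⟨0, by omega⟩) (k := ⟨1, by omega⟩) (by simp) (-round (t / T))
  rw [← ht] at h
  have e : t + ((-round (t / T) : ℤ) : ℝ) * T = (t / T - round (t / T)) * T := by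
    push_cast; field_simp; ring
  rw [e, abs_mul, abs_of_pos hT] at h
  have := abs_sub_round (t / T)
  nlinarith

theorem separation_sub_le {r : ℕ} (T : ℝ) {τ σ : Fin r → ℝ} {δ : ℝ} (h : ∀ k, |τ k - σ k| ≤ δ)
    (j k : Fin r) (hjk : j ≠ k) (p : ℤ) :
    separation T τ - 2 * δ ≤ |σ j - σ k + p * T| := by
  have h1 := separation_le T τ hjk p
  have h2 : |τ j - τ k + p * T| ≤ |σ j - σ k + p * T| + |τ j - σ j| + |τ k - σ k| := by
    calc _ = |(σ j - σ k + p * T) + (τ j - σ j) - (τ k - σ k)| := by congr 1; ring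
      _ ≤ _ := (abs_sub _ _).trans (by gcongr; exact abs_add_le _ _)
  linarith [h j, h k]

theorem exists_perm_of_matchingDist_le {r : ℕ} {τ' τ : Fin r → ℝ} {δ : ℝ}
    (h : matchingDist τ' τ ≤ δ) : ∃ π : Equiv.Perm (Fin r), ∀ k, |τ k - τ' (π k)| ≤ δ := by
  obtain ⟨π, hπ⟩ := exists_eq_ciInf_of_finite
    (f := fun π : Equiv.Perm (Fin r) => ⨆ k : Fin r, |τ k - τ' (π k)|)
  refine ⟨π, fun k => ?_⟩
  rw [matchingDist, ← hπ] at h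
  exact (le_ciSup (f := fun k => |τ k - τ' (π k)|) (Set.finite_range _).bddAbove k).trans h

theorem frobenius_norm_sq {l m : Type*} [Fintype l] [Fintype m] (A : Matrix l m ℂ) :
    ‖A‖ ^ 2 = ∑ j, ∑ i, ‖A i j‖ ^ 2 := by
  rw [Matrix.frobenius_norm_def, ← Real.rpow_natCast, ← Real.rpow_mul (by positivity),
    Finset.sum_comm]
  norm_num

theorem frobenius_norm_sq_smul_add {l m : Type*} [Fintype l] [Fintype m] (X Z : Matrix l m ℂ) :
    ∃ R : ℝ, ∀ c : ℝ, ‖(c : ℂ) • X + Z‖ ^ 2 = c ^ 2 * ‖X‖ ^ 2 + 2 * c * R + ‖Z‖ ^ 2 := by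
  refine ⟨∑ j, ∑ i, (X i j * star (Z i j)).re, fun c => ?_⟩
  simp only [frobenius_norm_sq, Finset.mul_sum, ← Finset.sum_add_distrib]
  refine Finset.sum_congr rfl fun j _ => Finset.sum_congr rfl fun i _ => ?_
  simp only [Matrix.add_apply, Matrix.smul_apply, smul_eq_mul, ← Complex.normSq_eq_norm_sq,
    Complex.normSq_apply, Complex.star_def, Complex.mul_re, Complex.add_re, Complex.add_im,
    Complex.mul_im, Complex.ofReal_re, Complex.ofReal_im, Complex.conj_re, Complex.conj_im]
  ring

theorem frobenius_norm_sq_le_of_minimal {l m : Type*} [Fintype l] [Fintype m] {X Z : Matrix l m ℂ}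
    (h : ∀ c : ℝ, ‖X + Z‖ ^ 2 ≤ ‖(c : ℂ) • X + Z‖ ^ 2) : ‖X‖ ^ 2 ≤ ‖Z‖ ^ 2 := by
  obtain ⟨R, hR⟩ := frobenius_norm_sq_smul_add X Z
  have h1 := hR 1
  rw [Complex.ofReal_one, one_smul] at h1
  have h0 : 0 ≤ ‖X + Z‖ ^ 2 := by positivity
  rcases (sq_nonneg ‖X‖).eq_or_lt with hX | hX
  · rw [← hX]; positivity
  · have hX0 : ‖X‖ ≠ 0 := fun h => by simp [h] at hX
    have h2 := h (-R / ‖X‖ ^ 2)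
    rw [hR, h1] at h2
    have e : (-R / ‖X‖ ^ 2) ^ 2 * ‖X‖ ^ 2 + 2 * (-R / ‖X‖ ^ 2) * R = -(R ^ 2 / ‖X‖ ^ 2) := by
      field_simp; ring
    have h3 : ‖X‖ ^ 2 + 2 * R + R ^ 2 / ‖X‖ ^ 2 ≤ 0 := by linarith
    have h4 : (‖X‖ ^ 2 + R) ^ 2 / ‖X‖ ^ 2 ≤ 0 := by
      refine le_of_eq_of_le ?_ h3
      field_simp; ring
    have h5 : (‖X‖ ^ 2 + R) ^ 2 ≤ 0 := by
      rw [div_le_iff₀ hX] at h4; linarith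
    have h6 : ‖X‖ ^ 2 + R = 0 := pow_eq_zero_iff two_ne_zero |>.1 (le_antisymm h5 (sq_nonneg _))
    linarith

theorem psfMatrix_mul_vandermonde_mul_apply {r L : ℕ} (T : ℝ) (n : ℕ) (g : ℝ → ℂ) (τ : Fin r → ℝ)
    (A : Matrix (Fin r) (Fin L) ℂ) (u : Fin (2 * n + 1)) (l : Fin L) :
    (psfMatrix T n g * vandermonde T n τ * A) u l =
      𝓕 g (freq T n u) * ∑ j, vandermonde T n τ u j * A j l := by
  rw [Matrix.mul_assoc, psfMatrix, Matrix.diagonal_mul, Matrix.mul_apply]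

theorem vandermonde_mul_submatrix {r L : ℕ} (T : ℝ) (n : ℕ) (τ : Fin r → ℝ)
    (π : Equiv.Perm (Fin r)) (A : Matrix (Fin r) (Fin L) ℂ) :
    vandermonde T n (τ ∘ π) * A.submatrix π id = vandermonde T n τ * A := by
  ext u l
  rw [Matrix.mul_apply, Matrix.mul_apply]
  exact Equiv.sum_comp π fun j => vandermonde T n τ u j * A j l

theorem IsLeastSquares.norm_sq_le {r L : ℕ} {T : ℝ} {n : ℕ} {g : ℝ → ℂ} {τ τh : Fin r → ℝ}
    {A Ah : Matrix (Fin r) (Fin L) ℂ}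
    (h : IsLeastSquares T n g (psfMatrix T n g * vandermonde T n τ * A) τh Ah)
    (π : Equiv.Perm (Fin r)) :
    ‖psfMatrix T n g * vandermonde T n (τh ∘ π) * (Ah.submatrix π id - A)‖ ^ 2 ≤
      ‖psfMatrix T n g * vandermonde T n (τh ∘ π) * A -
        psfMatrix T n g * vandermonde T n τ * A‖ ^ 2 := by
  set A' := Ah.submatrix π id
  set G := psfMatrix T n g
  set W := vandermonde T n (τh ∘ π) with hW
  refine frobenius_norm_sq_le_of_minimal fun c => ?_
  have h1 := h ((A + (c : ℂ) • (A' - A)).submatrix π.symm id)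
  simp only [loss] at h1
  have e1 : G * vandermonde T n τh * Ah = G * W * A' := by
    rw [Matrix.mul_assoc, Matrix.mul_assoc, vandermonde_mul_submatrix]
  have e2 : G * vandermonde T n τh * (A + (c : ℂ) • (A' - A)).submatrix π.symm id =
      G * W * (A + (c : ℂ) • (A' - A)) := by
    rw [Matrix.mul_assoc, Matrix.mul_assoc, hW, ← vandermonde_mul_submatrix T n τh π]
    simp [Matrix.submatrix_submatrix]
  rw [e1, e2] at h1
  have e3 : G * W * (A' - A) + (G * W * A - G * vandermonde T n τ * A) =
      G * W * A' - G * vandermonde T n τ * A := by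
    rw [Matrix.mul_sub]; abel
  have e4 : (c : ℂ) • (G * W * (A' - A)) + (G * W * A - G * vandermonde T n τ * A) =
      G * W * (A + (c : ℂ) • (A' - A)) - G * vandermonde T n τ * A := by
    rw [Matrix.mul_add, Matrix.mul_smul]; abel
  rw [e3, e4]
  linarith

/-- The derivative of the weighted exponential sum when the locations move along a segment. -/
theorem hasDerivAt_vandermonde_segment {r : ℕ} (T : ℝ) (n : ℕ) (g : ℝ → ℂ) (τ η : Fin r → ℝ)
    (a : Fin r → ℂ) (u : Fin (2 * n + 1)) (s : ℝ) :
    HasDerivAt (fun s : ℝ => 𝓕 g (freq T n u) *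
        ∑ j, vandermonde T n (fun j => τ j + s * η j) u j * a j)
      (derivSpectrum g (freq T n u) *
        ∑ j, vandermonde T n (fun j => τ j + s * η j) u j * (-(η j) * a j)) s := by
  have h1 : ∀ j, HasDerivAt (fun s : ℝ => vandermonde T n (fun j => τ j + s * η j) u j * a j)
      (vandermonde T n (fun j => τ j + s * η j) u j *
        (-2 * Complex.I * Real.pi * freq T n u * η j) * a j) s := by
    intro j
    simp only [vandermonde, Matrix.of_apply]
    have h2 : HasDerivAt (fun s : ℝ => ((τ j + s * η j : ℝ) : ℂ)) (η j : ℂ) s := by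
      have := ((hasDerivAt_id s).mul_const (η j)).const_add (τ j)
      simpa using this.ofReal_comp
    exact (((h2.const_mul (-2 * Complex.I * Real.pi * freq T n u)).cexp).mul_const (a j))
  refine ((HasDerivAt.fun_sum fun j _ => h1 j).const_mul (𝓕 g (freq T n u))).congr_deriv ?_
  rw [derivSpectrum, Finset.mul_sum, Finset.mul_sum]
  refine Finset.sum_congr rfl fun j _ => ?_
  ring

theorem sum_norm_sq_vandermonde_sub_le {r : ℕ} (T : ℝ) (n : ℕ) (g : ℝ → ℂ) {τ σ : Fin r → ℝ}
    {δ M : ℝ} (hM : 0 ≤ M) (hσ : ∀ k, |τ k - σ k| ≤ δ)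
    (hbound : ∀ ρ : Fin r → ℝ, (∀ k, |τ k - ρ k| ≤ δ) → ∀ a : Fin r → ℂ,
      ∑ u, ‖derivSpectrum g (freq T n u) * ∑ j, vandermonde T n ρ u j * a j‖ ^ 2 ≤
        M * ∑ j, ‖a j‖ ^ 2) (a : Fin r → ℂ) :
    ∑ u, ‖𝓕 g (freq T n u) * ∑ j, vandermonde T n σ u j * a j -
      𝓕 g (freq T n u) * ∑ j, vandermonde T n τ u j * a j‖ ^ 2 ≤
        M * (δ ^ 2 * ∑ j, ‖a j‖ ^ 2) := by
  set η : Fin r → ℝ := fun j => σ j - τ j with hη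
  have hηδ : ∀ j, |η j| ≤ δ := fun j => by simp only [hη]; rw [abs_sub_comm]; exact hσ j
  set e := ((PiLp.continuousLinearEquiv 2 ℝ (fun _ : Fin (2 * n + 1) => ℂ)).symm :
    (Fin (2 * n + 1) → ℂ) →L[ℝ] EuclideanSpace ℂ (Fin (2 * n + 1)))
  set v : ℝ → Fin (2 * n + 1) → ℂ := fun s u => 𝓕 g (freq T n u) *
        ∑ j, vandermonde T n (fun j => τ j + s * η j) u j * a j with hv
  set v' : ℝ → Fin (2 * n + 1) → ℂ := fun s u => derivSpectrum g (freq T n u) *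
        ∑ j, vandermonde T n (fun j => τ j + s * η j) u j * (-(η j) * a j) with hv'
  have hd : ∀ s, HasDerivAt v (v' s) s := fun s =>
    hasDerivAt_pi.2 fun u => hasDerivAt_vandermonde_segment T n g τ η a u s
  have hnorm : ∀ w : Fin (2 * n + 1) → ℂ, ‖e w‖ ^ 2 = ∑ u, ‖w u‖ ^ 2 := fun w =>
    EuclideanSpace.norm_sq_eq (e w)
  have hA : 0 ≤ ∑ j, ‖a j‖ ^ 2 := Finset.sum_nonneg fun _ _ => by positivity
  have hle : ∀ s ∈ Set.Ico (0 : ℝ) 1, ‖e (v' s)‖ ≤ Real.sqrt (M * (δ ^ 2 * ∑ j, ‖a j‖ ^ 2)) := by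
    intro s hs
    apply Real.le_sqrt_of_sq_le
    rw [hnorm]
    refine (hbound (fun j => τ j + s * η j) (fun k => ?_) (fun j => -(η j) * a j)).trans ?_
    · rw [sub_add_cancel_left, abs_neg, abs_mul, abs_of_nonneg hs.1]
      nlinarith [hηδ k, abs_nonneg (η k), hs.2, hs.1]
    · gcongr
      rw [Finset.mul_sum]
      refine Finset.sum_le_sum fun j _ => ?_
      rw [norm_mul, norm_neg, Complex.norm_real, mul_pow, Real.norm_eq_abs]
      gcongr
      exact hηδ j
  have hmv := norm_image_sub_le_of_norm_deriv_le_segment_01' (f := fun s => e (v s))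
    (f' := fun s => e (v' s))
    (fun s _ => (e.hasFDerivAt.comp_hasDerivAt s (hd s)).hasDerivWithinAt) hle
  have hsq : ‖e (v 1) - e (v 0)‖ ^ 2 ≤ _ := pow_le_pow_left₀ (norm_nonneg _) hmv 2
  rw [Real.sq_sqrt (by positivity)] at hsq
  rw [← map_sub, hnorm] at hsq
  simpa [hv, hη] using hsq

theorem lower_frame_bound {r : ℕ} {T : ℝ} (hT : 0 < T) (n : ℕ) {h : ℝ → ℂ}
    (hc : Continuous h) (hV : bandVariation T n h ≠ ⊤) {τ : Fin r → ℝ} {D : ℝ} (hD0 : 0 < D)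
    (hDT : D ≤ T) (hτ : ∀ j k, j ≠ k → ∀ p : ℤ, D ≤ |τ j - τ k + p * T|) (a : Fin r → ℂ) :
    T * (bandEnergy T n h - 1 / 2 * (bandVariation T n h).toReal * D⁻¹) * ∑ j, ‖a j‖ ^ 2 ≤
      ∑ u, ‖h (freq T n u) * ∑ j, vandermonde T n τ u j * a j‖ ^ 2 := by
  have := (abs_le.1 (abs_weighted_vandermonde_sub_le hT n hc hV hD0 hDT hτ a)).1
  linarith

theorem upper_frame_bound {r : ℕ} {T : ℝ} (hT : 0 < T) (n : ℕ) {h : ℝ → ℂ}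
    (hc : Continuous h) (hV : bandVariation T n h ≠ ⊤) {τ : Fin r → ℝ} {D : ℝ} (hD0 : 0 < D)
    (hDT : D ≤ T) (hτ : ∀ j k, j ≠ k → ∀ p : ℤ, D ≤ |τ j - τ k + p * T|) (a : Fin r → ℂ) :
    ∑ u, ‖h (freq T n u) * ∑ j, vandermonde T n τ u j * a j‖ ^ 2 ≤
      T * (bandEnergy T n h + 1 / 2 * (bandVariation T n h).toReal * D⁻¹) * ∑ j, ‖a j‖ ^ 2 := by
  have := (abs_le.1 (abs_weighted_vandermonde_sub_le hT n hc hV hD0 hDT hτ a)).2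
  linarith

end SpikeDeconv

theorem lemma3 (T : ℝ) (hT : 0 < T) (n r L : ℕ) (hr : 2 ≤ r)
    (g : ℝ → ℂ) (hg : Integrable g)
    (hE : SpikeDeconv.bandEnergy T n (𝓕 g) ≠ 0)
    (hV : SpikeDeconv.bandVariation T n (𝓕 g) ≠ ⊤)
    (τs τh : Fin r → ℝ) (As Ah : Matrix (Fin r) (Fin L) ℂ) (hAs : As ≠ 0) (δ : ℝ)
    (hmd : SpikeDeconv.matchingDist τh τs ≤ δ)
    (hsep : 1 / 2 * SpikeDeconv.flatness T n (𝓕 g) < SpikeDeconv.separation T τs - 2 * δ)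
    (hLS : SpikeDeconv.IsLeastSquares T n g
      (SpikeDeconv.psfMatrix T n g * SpikeDeconv.vandermonde T n τs * As) τh Ah) :
    (∃ π : Equiv.Perm (Fin r), ∀ k, |τs k - τh (π k)| ≤ δ) ∧
    ∀ π : Equiv.Perm (Fin r), (∀ k, |τs k - τh (π k)| ≤ δ) →
      ‖As - Ah.submatrix π id‖ / ‖As‖ ≤
        δ * Real.sqrt
          (SpikeDeconv.bandEnergy T n (SpikeDeconv.derivSpectrum g) /
              SpikeDeconv.bandEnergy T n (𝓕 g) *
            ((1 + 2 / 3 * SpikeDeconv.flatness T n (SpikeDeconv.derivSpectrum g) *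
                (SpikeDeconv.separation T τs - 2 * δ)⁻¹) /
              (1 - 1 / 2 * SpikeDeconv.flatness T n (𝓕 g) *
                (SpikeDeconv.separation T τs - 2 * δ)⁻¹))) := by
  refine ⟨SpikeDeconv.exists_perm_of_matchingDist_le hmd, fun π hπ => ?_⟩
  set D := SpikeDeconv.separation T τs - 2 * δ with hD
  set Eg := SpikeDeconv.bandEnergy T n (𝓕 g) with hEg
  set Ed := SpikeDeconv.bandEnergy T n (SpikeDeconv.derivSpectrum g) with hEd
  have hE0 : 0 < Eg := lt_of_le_of_ne (SpikeDeconv.bandEnergy_nonneg _ _ _) (Ne.symm hE)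
  have hEd_ne := SpikeDeconv.bandEnergy_derivSpectrum_ne_zero hg hE
  have hEd0 : 0 < Ed := lt_of_le_of_ne (SpikeDeconv.bandEnergy_nonneg _ _ _) (Ne.symm hEd_ne)
  have hVd := SpikeDeconv.bandVariation_derivSpectrum_ne_top hV
  have hρg := SpikeDeconv.bandEnergy_mul_flatness hE
  have hρd := SpikeDeconv.bandEnergy_mul_flatness hEd_ne
  rw [← hEg] at hρg
  rw [← hEd] at hρd
  set ρg := SpikeDeconv.flatness T n (𝓕 g)
  set ρd := SpikeDeconv.flatness T n (SpikeDeconv.derivSpectrum g)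
  have hρg0 : 0 ≤ ρg := by
    refine nonneg_of_mul_nonneg_right ?_ hE0
    rw [hρg]; positivity
  have hρd0 : 0 ≤ ρd := by
    refine nonneg_of_mul_nonneg_right ?_ hEd0
    rw [hρd]; positivity
  have hD0 : 0 < D := by linarith
  have hδ : 0 ≤ δ := (abs_nonneg _).trans (hπ ⟨0, by omega⟩)
  have hDT : D ≤ T := by linarith [SpikeDeconv.separation_le_period hr hT τs]
  set A' := Ah.submatrix π id with hA'
  have hden : 0 < 1 - 1 / 2 * ρg * D⁻¹ := by
    rw [sub_pos, ← div_eq_mul_inv, div_lt_one hD0]; exact hsep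
  set M := T * (Ed * (1 + 1 / 2 * ρd * D⁻¹)) with hM
  set m := T * (Eg * (1 - 1 / 2 * ρg * D⁻¹)) with hm
  have hm0 : 0 < m := by positivity
  have hM0 : 0 ≤ M := by positivity
  have hlow : m * ‖A' - As‖ ^ 2 ≤ ‖SpikeDeconv.psfMatrix T n g *
      SpikeDeconv.vandermonde T n (τh ∘ π) * (A' - As)‖ ^ 2 := by
    rw [SpikeDeconv.frobenius_norm_sq, SpikeDeconv.frobenius_norm_sq, Finset.mul_sum]
    refine Finset.sum_le_sum fun l _ => ?_
    have h := SpikeDeconv.lower_frame_bound hT n (SpikeDeconv.continuous_fourier hg) hV hD0 hDT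
      (SpikeDeconv.separation_sub_le T (σ := τh ∘ π) hπ) (fun j => (A' - As) j l)
    rw [← hEg, ← hρg] at h
    simp only [SpikeDeconv.psfMatrix_mul_vandermonde_mul_apply]
    refine le_of_eq_of_le ?_ h
    rw [hm]; ring
  have hup : ‖SpikeDeconv.psfMatrix T n g * SpikeDeconv.vandermonde T n (τh ∘ π) * As -
      SpikeDeconv.psfMatrix T n g * SpikeDeconv.vandermonde T n τs * As‖ ^ 2 ≤
      M * (δ ^ 2 * ‖As‖ ^ 2) := by
    rw [SpikeDeconv.frobenius_norm_sq, SpikeDeconv.frobenius_norm_sq, Finset.mul_sum,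
      Finset.mul_sum]
    refine Finset.sum_le_sum fun l _ => ?_
    simp only [Matrix.sub_apply, SpikeDeconv.psfMatrix_mul_vandermonde_mul_apply]
    refine SpikeDeconv.sum_norm_sq_vandermonde_sub_le T n g hM0 (σ := τh ∘ π) hπ
      (fun ρ hρ a => ?_) (fun j => As j l)
    have h := SpikeDeconv.upper_frame_bound hT n (SpikeDeconv.continuous_derivSpectrum hg) hVd hD0
      hDT (SpikeDeconv.separation_sub_le T hρ) a
    rw [← hEd, ← hρd] at h
    refine h.trans_eq ?_
    rw [hM]; ring
  have hmain : m * ‖A' - As‖ ^ 2 ≤ M * (δ ^ 2 * ‖As‖ ^ 2) :=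
    hlow.trans ((hLS.norm_sq_le π).trans hup)
  have hAs0 : 0 < ‖As‖ := norm_pos_iff.2 hAs
  have hMm : M / m ≤ Ed / Eg * ((1 + 2 / 3 * ρd * D⁻¹) / (1 - 1 / 2 * ρg * D⁻¹)) := by
    rw [hM, hm, mul_div_mul_left _ _ hT.ne', mul_div_mul_comm]
    refine mul_le_mul_of_nonneg_left (div_le_div_of_nonneg_right ?_ hden.le) (by positivity)
    nlinarith [mul_nonneg hρd0 (inv_nonneg.2 hD0.le)]
  calc ‖As - A'‖ / ‖As‖ ≤ δ * Real.sqrt (M / m) := by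
        rw [← Real.sqrt_sq hδ, ← Real.sqrt_mul (sq_nonneg δ)]
        apply Real.le_sqrt_of_sq_le
        rw [norm_sub_rev, div_pow, div_le_iff₀ (by positivity)]
        have e : δ ^ 2 * (M / m) * ‖As‖ ^ 2 = M * (δ ^ 2 * ‖As‖ ^ 2) / m := by ring
        rw [e, le_div_iff₀ hm0]
        linarith
    _ ≤ _ := by gcongr
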